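/- Let $H$ be a separable real Hilbert space, let $T\in(0,\infty)$, let $(\Omega,\mathcal F,\mathbb P)$ be a probability space with a normal filtration $(\mathbb F_t)_{t\in[0,T]}$, let $(W_t)_{t\in[0,T]}$ be an $\mathrm{id}_H$-cylindrical $(\mathbb F_t)$-Wiener process, let $\mathbb H\subseteq H$ be an orthonormal basis of $H$, let $\delta\in(-\infty,\tfrac14)$, let $e\colon\{1,2,3,\dots\}\to\mathbb H$ be a bijection, let $\lambda\colon\mathbb H\to\mathbb R$ satisfy $\lambda_{e_n}=-\pi^2n^2$ for all $n\ge 1$, and let $\mu\colon\mathbb H\to\mathbb R$ satisfy $|\mu_h|=|\lambda_h|^{\delta}$ for all $h\in\mathbb H$ (so that $\sum_{h\in\mathbb H}|\mu_h|^2/|\lambda_h|<\infty$). Let $A$ be the diagonal operator on $H$ with $Ah=\lambda_h h$ for $h\in\mathbb H$ and $D(A)=\{v\in H:\sum_{h\in\mathbb H}|\lambda_h\langle h,v\rangle_H|^2<\infty\}$. For $r\in\mathbb R$ let $H_r$ be the interpolation spaces associated to $-A$, that is, the Hilbert space of formal series $u=\sum_{h\in\mathbb H}u_hh$ with $\|u\|_{H_r}^2=\sum_{h\in\mathbb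 H}|\lambda_h|^{2r}|u_h|^2<\infty$ (so $H_0=H$), and let $\mathbf H_r=H_{r/2}\times H_{r/2-1/2}$ with the product inner product; in particular $\mathbf H_0=H_0\times H_{-1/2}$. Let $\mathbf A\colon D(\mathbf A)\subseteq\mathbf H_0\to\mathbf H_0$ be the operator with $D(\mathbf A)=\mathbf H_1$ and $\mathbf A(v,w)=(w,Av)$ (with $A$ extended to $H_{1/2}\to H_{-1/2}$), let $(e^{t\mathbf A})_{t\ge0}$ be the strongly continuous semigroup on $\mathbf H_0$ generated by $\mathbf A$, for $I\subseteq\mathbb H$ let $\mathbf P_I(v,w)=\bigl(\sum_{h\in I}v_hh,\sum_{h\in I}w_hh\bigr)$, and let $\mathbf B\colon H\to\mathbf H_0$ be the Hilbert–Schmidt operator $\mathbf Bv=\bigl(0,\sum_{h\in\mathbb H}\mu_h\langle h,v\rangle_Hh\bigr)$. For every $I\subseteq\mathbb H$ let $\mathbf X^I\colon\Omega\to\mathbf P_I(\mathbf H_0)$ be a random variable with $$\mathbf X^I=\int_0^Te^{(T-s)\mathbf A}\,\mathbf P_I\mathbf B\,dW_s\qquad\mathbb P\text{-a.s.}$$ Let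 $I_N=\{e_1,\dots,e_N\}$ for $N\ge1$, and let $\varphi_1,\varphi_2\colon\mathbf H_0\to\mathbb R$ be given by $\varphi_1(v_1,v_2)=\exp(-\|v_1\|_{H_0}^2)$ and $\varphi_2(v_1,v_2)=\exp(-\|v_2\|_{H_{-1/2}}^2)$. Then for all $i\in\{1,2\}$ and all $N\in\{1,2,3,\dots\}$ the function $\varphi_i$ belongs to $C^2_{\mathrm b}(\mathbf H_0,\mathbb R)$ (it is bounded and twice continuously Fréchet differentiable with bounded derivatives), and $$\mathbb E\bigl[\varphi_i(\mathbf X^{I_N})\bigr]-\mathbb E\bigl[\varphi_i(\mathbf X^{\mathbb H})\bigr]\;\ge\;\biggl[1+\inf_{x\in[2\pi T,\infty)}\frac{\sin(x)}{(-1)^i\,x}\biggr]\frac{T\,(4\pi^2)^{2\delta-1}\,N^{4\delta-1}}{[1-4\delta]\,\exp\Bigl(\frac{12(2\delta-1)T\pi^{4\delta-2}}{4\delta-1}\Bigr)}\;>\;0 .$$ -/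

import Mathlib

open MeasureTheory ProbabilityTheory Filter Topology Set
open scoped NNReal ENNReal

namespace StochWave

/-! ### Interpolation spaces of a diagonal operator -/

/-- A function `λ : ι → ℝ` with `sup λ < 0`: the eigenvalues of the diagonal operator `A`,
indexed by the elements of an orthonormal basis. -/
structure NegSpectrum (ι : Type*) where
  val : ι → ℝ
  sup_neg : ∃ c < 0, ∀ h, val h ≤ c

instance {ι : Type*} : CoeFun (NegSpectrum ι) (fun _ => ι → ℝ) := ⟨NegSpectrum.val⟩

section Interp

variable {ι : Type*} (lam : NegSpectrum ι) (r : ℝ)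

theorem NegSpectrum.abs_pos (h : ι) : 0 < |lam h| := by
  obtain ⟨c, hc, hl⟩ := lam.sup_neg
  exact _root_.abs_pos.2 (ne_of_lt ((hl h).trans_lt hc))

theorem NegSpectrum.rpow_pos (h : ι) : 0 < |lam h| ^ r :=
  Real.rpow_pos_of_pos (lam.abs_pos h) r

theorem summable_mul_of_sq {f g : ι → ℝ} (hf : Summable fun h => f h ^ 2)
    (hg : Summable fun h => g h ^ 2) : Summable fun h => f h * g h := by
  refine Summable.of_norm_bounded (hf.add hg) fun h => ?_
  rw [Real.norm_eq_abs, abs_mul]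
  nlinarith [sq_nonneg (|f h| - |g h|), sq_abs (f h), sq_abs (g h), abs_nonneg (f h),
    abs_nonneg (g h), mul_nonneg (abs_nonneg (f h)) (abs_nonneg (g h))]

/-- Coefficient families `(u_h)` of the formal series `∑ u_h h` (`h` running through the
orthonormal basis) with `∑ |λ_h|^(2r) |u_h|² < ∞`. -/
def interpSubmodule : Submodule ℝ (ι → ℝ) where
  carrier := {u | Summable fun h => (|lam h| ^ r * u h) ^ 2}
  zero_mem' := by simp
  add_mem' := by
    intro u v hu hv
    refine ((hu.add hv).add ((summable_mul_of_sq hu hv).mul_left 2)).congr fun h => ?_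
    simp only [Pi.add_apply]
    ring
  smul_mem' := by
    intro c u hu
    refine (hu.mul_left (c ^ 2)).congr fun h => ?_
    simp only [Pi.smul_apply, smul_eq_mul]
    ring

/-- The interpolation space `H_r` associated to `-A`, where `A` has eigenvalues `λ_h`. An element
`∑ u_h h` of `H_r` is represented by its coefficient family `u`; thus all `H_r` sit in the common
space `ι → ℝ`, the space `H` is `H_0` through `v ↦ (⟨h, v⟩)_h`, for `r ≥ 0` the space `H_r` is the
domain of `(-A)^r`, and for `r < 0` it is the completion of `H` in the norm `‖(-A)^r v‖`. -/
def HSp : Type _ := ↥(interpSubmodule lam r)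

instance : AddCommGroup (HSp lam r) := inferInstanceAs (AddCommGroup (interpSubmodule lam r))

noncomputable instance : Module ℝ (HSp lam r) :=
  inferInstanceAs (Module ℝ (interpSubmodule lam r))

variable {lam r}

/-- The coefficient family of an element of `H_r`. -/
def HSp.coeff (u : HSp lam r) : ι → ℝ := Subtype.val (p := (· ∈ interpSubmodule lam r)) u

instance : CoeFun (HSp lam r) (fun _ => ι → ℝ) := ⟨HSp.coeff⟩

/-- The element of `H_r` with the given coefficient family. -/
def HSp.mk (u : ι → ℝ) (hu : Summable fun h => (|lam h| ^ r * u h) ^ 2) : HSp lam r :=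
  (⟨u, hu⟩ : interpSubmodule lam r)

theorem HSp.summable (u : HSp lam r) : Summable fun h => (|lam h| ^ r * u h) ^ 2 :=
  Subtype.property (p := (· ∈ interpSubmodule lam r)) u

theorem HSp.ext {u v : HSp lam r} (huv : ∀ h, u h = v h) : u = v :=
  Subtype.ext (p := (· ∈ interpSubmodule lam r)) (funext huv)

@[simp] theorem HSp.mk_apply (u : ι → ℝ) (hu : Summable fun h => (|lam h| ^ r * u h) ^ 2) (h : ι) :
    HSp.mk u hu h = u h := rfl

@[simp] theorem HSp.zero_apply (h : ι) : (0 : HSp lam r) h = 0 := rfl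

@[simp] theorem HSp.add_apply (u v : HSp lam r) (h : ι) : (u + v) h = u h + v h := rfl

@[simp] theorem HSp.sub_apply (u v : HSp lam r) (h : ι) : (u - v) h = u h - v h := rfl

@[simp] theorem HSp.smul_apply (c : ℝ) (u : HSp lam r) (h : ι) : (c • u) h = c * u h := rfl

variable (lam r)

/-- The inner product `⟨u, v⟩ = ∑ |λ_h|^(2r) u_h v_h` of `H_r`. -/
@[reducible] noncomputable def interpCore : InnerProductSpace.Core ℝ (HSp lam r) where
  inner u v := ∑' h, (|lam h| ^ r * u h) * (|lam h| ^ r * v h)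
  conj_inner_symm u v := by
    simp only [conj_trivial]
    exact tsum_congr fun h => mul_comm _ _
  re_inner_nonneg u := tsum_nonneg fun h => mul_self_nonneg _
  add_left u v w := by
    rw [← (summable_mul_of_sq u.summable w.summable).tsum_add
      (summable_mul_of_sq v.summable w.summable)]
    refine tsum_congr fun h => ?_
    rw [HSp.add_apply]
    ring
  smul_left u v c := by
    simp only [conj_trivial]
    rw [← tsum_mul_left]
    refine tsum_congr fun h => ?_
    rw [HSp.smul_apply]
    ring
  definite u hu := by
    have hs : Summable fun h => (|lam h| ^ r * u h) * (|lam h| ^ r * u h) :=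
      summable_mul_of_sq u.summable u.summable
    have h0 := (hs.hasSum_iff.2 hu)
    rw [hasSum_zero_iff_of_nonneg fun h => mul_self_nonneg _] at h0
    refine HSp.ext fun h => ?_
    have h1 := mul_self_eq_zero.1 (congrFun h0 h)
    exact (mul_eq_zero.1 h1).resolve_left (lam.rpow_pos r h).ne'

noncomputable instance : NormedAddCommGroup (HSp lam r) :=
  (interpCore lam r).toNormedAddCommGroup

noncomputable instance : InnerProductSpace ℝ (HSp lam r) :=
  InnerProductSpace.ofCore (interpCore lam r).toCore

variable {lam r}

theorem HSp.norm_sq (u : HSp lam r) : ‖u‖ ^ 2 = ∑' h, (|lam h| ^ r * u h) ^ 2 := by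
  rw [← real_inner_self_eq_norm_sq]
  exact tsum_congr fun h => (sq _).symm

variable (lam r)

/-- The Hilbert space `𝐇_r = H_{r/2} × H_{r/2-1/2}` with its product inner product. -/
abbrev BH : Type _ := WithLp 2 (HSp lam (r / 2) × HSp lam (r / 2 - 1 / 2))


/-! ### The operators `P_I`, `𝐏_I`, `𝐀` and `𝐁` -/

/-- `P_I` on `H_r`: the orthogonal projection `∑_h u_h h ↦ ∑_{h ∈ I} u_h h`. -/
noncomputable def projH (I : Set ι) : HSp lam r →L[ℝ] HSp lam r :=
  LinearMap.mkContinuous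
    { toFun := fun u => HSp.mk (I.indicator u) (by
        refine Summable.of_nonneg_of_le (fun h => sq_nonneg _) (fun h => ?_) u.summable
        by_cases hI : h ∈ I
        · simp [hI]
        · simpa [hI] using sq_nonneg _)
      map_add' := fun u v => HSp.ext fun h => by
        by_cases hI : h ∈ I <;> simp [hI]
      map_smul' := fun c u => HSp.ext fun h => by
        by_cases hI : h ∈ I <;> simp [hI] }
    1 (fun u => by
      rw [one_mul]
      refine (sq_le_sq₀ (norm_nonneg _) (norm_nonneg _)).1 ?_
      rw [HSp.norm_sq, HSp.norm_sq]
      refine Summable.tsum_le_tsum (fun h => ?_) (HSp.summable _) u.summable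
      by_cases hI : h ∈ I
      · simp [hI]
      · simpa [hI] using sq_nonneg _)

/-- `𝐏_I (v, w) = (P_I v, P_I w)` on `𝐇_r`. -/
noncomputable def projBH (I : Set ι) : BH lam r →L[ℝ] BH lam r :=
  (WithLp.prodContinuousLinearEquiv 2 ℝ _ _).symm.toContinuousLinearMap ∘L
    ((projH lam (r / 2) I).prodMap (projH lam (r / 2 - 1 / 2) I)) ∘L
      (WithLp.prodContinuousLinearEquiv 2 ℝ _ _).toContinuousLinearMap

theorem wt_zero (h : ι) : |lam h| ^ ((0 : ℝ) / 2) = 1 := by simp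

theorem wt_half (h : ι) : |lam h| ^ ((0 : ℝ) / 2 - 1 / 2) = (√|lam h|)⁻¹ := by
  rw [zero_div, zero_sub, Real.rpow_neg (abs_nonneg _), Real.sqrt_eq_rpow]

theorem wt_one (h : ι) : |lam h| ^ ((1 : ℝ) / 2 - 1 / 2) = 1 := by simp

theorem wt_sqrt (h : ι) : |lam h| ^ ((1 : ℝ) / 2) = √|lam h| := by
  rw [Real.sqrt_eq_rpow]

theorem NegSpectrum.sqrt_pos (h : ι) : 0 < √|lam h| := Real.sqrt_pos.2 (lam.abs_pos h)

theorem NegSpectrum.eq_neg_sq (h : ι) : lam h = -(√|lam h|) ^ 2 := by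
  obtain ⟨c, hc, hl⟩ := lam.sup_neg
  rw [Real.sq_sqrt (abs_nonneg _), abs_of_neg ((hl h).trans_lt hc), neg_neg]

/-- The operator `𝐀 : D(𝐀) ⊆ 𝐇_0 → 𝐇_0`, `D(𝐀) = 𝐇_1 = H_{1/2} × H_0`, `𝐀 (v, w) = (w, A v)`,
where `A ∑ v_h h = ∑ λ_h v_h h`. -/
noncomputable def waveOp : BH lam 0 →ₗ.[ℝ] BH lam 0 where
  domain :=
    { carrier := {x | x.fst.coeff ∈ interpSubmodule lam (1 / 2) ∧
        x.snd.coeff ∈ interpSubmodule lam (1 / 2 - 1 / 2)}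
      zero_mem' := ⟨zero_mem _, zero_mem _⟩
      add_mem' := fun hx hy => ⟨add_mem hx.1 hy.1, add_mem hx.2 hy.2⟩
      smul_mem' := fun c _ hx => ⟨Submodule.smul_mem _ c hx.1, Submodule.smul_mem _ c hx.2⟩ }
  toFun :=
    { toFun := fun x => WithLp.toLp 2
        (HSp.mk x.1.snd (by
            refine Summable.congr x.2.2 fun h => ?_
            rw [wt_zero, wt_one]),
         HSp.mk (fun h => lam h * x.1.fst h) (by
            refine Summable.congr x.2.1 fun h => ?_
            have h0 := (lam.sqrt_pos h).ne'
            have h1 := lam.eq_neg_sq h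
            rw [wt_half, wt_sqrt]
            generalize √|lam h| = a at *
            rw [h1]
            field_simp))
      map_add' := fun x y => by
        refine WithLp.ofLp_injective 2 (Prod.ext (HSp.ext fun h => rfl) (HSp.ext fun h => ?_))
        change lam h * (x.1.fst h + y.1.fst h) = lam h * x.1.fst h + lam h * y.1.fst h
        ring
      map_smul' := fun c x => by
        refine WithLp.ofLp_injective 2 (Prod.ext (HSp.ext fun h => rfl) (HSp.ext fun h => ?_))
        change lam h * (c * x.1.fst h) = c * (lam h * x.1.fst h)
        ring }

variable {lam} in
theorem noise_bound {H : Type*} [NormedAddCommGroup H] [InnerProductSpace ℝ H]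
    (b : HilbertBasis ι ℝ H) (mu : ι → ℝ) (v : H) (h : ι) :
    (|lam h| ^ ((0 : ℝ) / 2 - 1 / 2) * (mu h * inner ℝ (b h) v)) ^ 2
      ≤ mu h ^ 2 / |lam h| * ‖v‖ ^ 2 := by
  have h1 : inner ℝ (b h) v ^ 2 ≤ ‖v‖ ^ 2 := by
    have h2 := abs_real_inner_le_norm (b h) v
    rw [b.orthonormal.1 h, one_mul] at h2
    exact sq_le_sq' (abs_le.1 h2).1 (abs_le.1 h2).2
  have h3 : (|lam h| ^ ((0 : ℝ) / 2 - 1 / 2)) ^ 2 = |lam h|⁻¹ := by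
    rw [wt_half, inv_pow, Real.sq_sqrt (abs_nonneg _)]
  rw [mul_pow, mul_pow, h3, div_eq_mul_inv]
  have h4 : 0 ≤ |lam h|⁻¹ * mu h ^ 2 := by positivity
  nlinarith [mul_le_mul_of_nonneg_left h1 h4]

/-- The operator `𝐁 : H → 𝐇_0`, `𝐁 v = (0, ∑_h μ_h ⟨h, v⟩ h)`, for the orthonormal basis `b` of
`H` and a family `μ` with `∑ |μ_h|² / |λ_h| < ∞`. -/
noncomputable def noiseOp {H : Type*} [NormedAddCommGroup H] [InnerProductSpace ℝ H]
    (b : HilbertBasis ι ℝ H) (mu : ι → ℝ) (hmu : Summable fun h => mu h ^ 2 / |lam h|) :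
    H →L[ℝ] BH lam 0 :=
  (WithLp.prodContinuousLinearEquiv 2 ℝ _ _).symm.toContinuousLinearMap ∘L
    ((0 : H →L[ℝ] HSp lam (0 / 2)).prod
      (LinearMap.mkContinuous
        { toFun := fun v => (HSp.mk (fun h => mu h * inner ℝ (b h) v)
            (Summable.of_nonneg_of_le (fun h => sq_nonneg _) (noise_bound b mu v)
              (hmu.mul_right _)) : HSp lam (0 / 2 - 1 / 2))
          map_add' := fun u v => HSp.ext fun h => by
            simp only [HSp.mk_apply, HSp.add_apply, inner_add_right, mul_add]
          map_smul' := fun c v => HSp.ext fun h => by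
            simp only [HSp.mk_apply, HSp.smul_apply, real_inner_smul_right, RingHom.id_apply]
            ring }
        √(∑' h, mu h ^ 2 / |lam h|) (fun v => by
          refine (sq_le_sq₀ (norm_nonneg _) (by positivity)).1 ?_
          rw [HSp.norm_sq, mul_pow, Real.sq_sqrt (tsum_nonneg fun h => by positivity),
            ← tsum_mul_right]
          exact Summable.tsum_le_tsum (noise_bound b mu v) (HSp.summable _)
            (hmu.mul_right _))))

end Interp

/-! ### The semigroup `e^{t𝐀}` -/

section Semigroup

variable {E : Type*} [NormedAddCommGroup E] [NormedSpace ℝ E]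

/-- `S` is the strongly continuous semigroup on `E` with infinitesimal generator `A`, that is,
`S t = e^{tA}`. -/
structure IsC0SemigroupGeneratedBy (S : ℝ≥0 → E →L[ℝ] E) (A : E →ₗ.[ℝ] E) : Prop where
  map_zero : S 0 = ContinuousLinearMap.id ℝ E
  map_add : ∀ s t, S (s + t) = S s ∘L S t
  tendsto_zero : ∀ x, Tendsto (fun t => S t x) (𝓝 0) (𝓝 x)
  generator : ∀ x y, (x, y) ∈ A.graph ↔
    Tendsto (fun t : ℝ≥0 => (t : ℝ)⁻¹ • (S t x - x)) (𝓝[>] 0) (𝓝 y)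

end Semigroup

section WaveSemigroup

variable {ι : Type*} {lam : NegSpectrum ι} {r : ℝ}

theorem HSp.tendsto_of_dominated {α : Type*} {l : Filter α} (f : α → HSp lam r) (g : HSp lam r)
    (bound : ι → ℝ) (hb : Summable bound)
    (hle : ∀ᶠ t in l, ∀ h, (|lam h| ^ r * (f t h - g h)) ^ 2 ≤ bound h)
    (hlim : ∀ h, Tendsto (fun t => |lam h| ^ r * (f t h - g h)) l (𝓝 0)) :
    Tendsto f l (𝓝 g) := by
  rw [tendsto_iff_norm_sub_tendsto_zero]
  have h1 : Tendsto (fun t => ‖f t - g‖ ^ 2) l (𝓝 0) := by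
    have h2 : Tendsto (fun t => ∑' h, (|lam h| ^ r * (f t h - g h)) ^ 2) l
        (𝓝 (∑' _ : ι, (0 : ℝ))) := by
      refine tendsto_tsum_of_dominated_convergence hb (fun h => ?_) ?_
      · simpa using (hlim h).pow 2
      · filter_upwards [hle] with t ht h
        rw [Real.norm_of_nonneg (sq_nonneg _)]
        exact ht h
    rw [tsum_zero] at h2
    refine h2.congr fun t => ?_
    rw [HSp.norm_sq]
    rfl
  have h3 := h1.sqrt
  rw [Real.sqrt_zero] at h3
  exact h3.congr fun t => Real.sqrt_sq (norm_nonneg _)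

theorem HSp.norm_apply_le (u : HSp lam r) (h : ι) : |(|lam h| ^ r * u h)| ≤ ‖u‖ := by
  refine abs_le_of_sq_le_sq ?_ (norm_nonneg _)
  rw [HSp.norm_sq]
  exact u.summable.le_tsum h fun _ _ => sq_nonneg _

theorem HSp.tendsto_apply {α : Type*} {l : Filter α} {f : α → HSp lam r} {g : HSp lam r}
    (hf : Tendsto f l (𝓝 g)) (h : ι) : Tendsto (fun t => f t h) l (𝓝 (g h)) := by
  rw [tendsto_iff_norm_sub_tendsto_zero] at hf ⊢
  have hw := lam.rpow_pos r h
  have h1 : Tendsto (fun t => (|lam h| ^ r)⁻¹ * ‖f t - g‖) l (𝓝 0) := by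
    simpa using hf.const_mul (|lam h| ^ r)⁻¹
  refine squeeze_zero (fun t => norm_nonneg _) (fun t => ?_) h1
  have h2 := HSp.norm_apply_le (f t - g) h
  rw [abs_mul, abs_of_pos hw, HSp.sub_apply] at h2
  rw [Real.norm_eq_abs, inv_mul_eq_div, le_div_iff₀ hw, mul_comm]
  exact h2

theorem BH.summable_fst (x : BH lam 0) : Summable fun h => x.fst h ^ 2 :=
  x.fst.summable.congr fun h => by rw [wt_zero, one_mul]

theorem BH.summable_snd (x : BH lam 0) : Summable fun h => ((√|lam h|)⁻¹ * x.snd h) ^ 2 :=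
  x.snd.summable.congr fun h => by rw [wt_half]

theorem BH.norm_sq (x : BH lam 0) :
    ‖x‖ ^ 2 = ∑' h, (x.fst h ^ 2 + ((√|lam h|)⁻¹ * x.snd h) ^ 2) := by
  rw [WithLp.prod_norm_sq_eq_of_L2, HSp.norm_sq, HSp.norm_sq,
    ← x.fst.summable.tsum_add x.snd.summable]
  exact tsum_congr fun h => by rw [wt_zero, wt_half, one_mul]

variable (lam) in
/-- The first coordinate of the rotation by the angle `|λ_h|^{1/2} t`. -/
noncomputable def waveFst (t : ℝ) (x : BH lam 0) : HSp lam (0 / 2) :=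
  HSp.mk (fun h => Real.cos (√|lam h| * t) * x.fst h
      + Real.sin (√|lam h| * t) * ((√|lam h|)⁻¹ * x.snd h)) (by
    refine Summable.of_nonneg_of_le (fun h => sq_nonneg _) (fun h => ?_)
      (x.summable_fst.add x.summable_snd)
    rw [wt_zero, one_mul]
    nlinarith [Real.sin_sq_add_cos_sq (√|lam h| * t),
      sq_nonneg (Real.sin (√|lam h| * t) * x.fst h
        - Real.cos (√|lam h| * t) * ((√|lam h|)⁻¹ * x.snd h))])

variable (lam) in
/-- The second coordinate of the rotation by the angle `|λ_h|^{1/2} t`. -/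
noncomputable def waveSnd (t : ℝ) (x : BH lam 0) : HSp lam (0 / 2 - 1 / 2) :=
  HSp.mk (fun h => √|lam h| * (-Real.sin (√|lam h| * t) * x.fst h
      + Real.cos (√|lam h| * t) * ((√|lam h|)⁻¹ * x.snd h))) (by
    refine Summable.of_nonneg_of_le (fun h => sq_nonneg _) (fun h => ?_)
      (x.summable_fst.add x.summable_snd)
    rw [wt_half, inv_mul_cancel_left₀ (lam.sqrt_pos h).ne']
    nlinarith [Real.sin_sq_add_cos_sq (√|lam h| * t),
      sq_nonneg (Real.cos (√|lam h| * t) * x.fst h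
        + Real.sin (√|lam h| * t) * ((√|lam h|)⁻¹ * x.snd h))])

theorem BH.ext {x y : BH lam r} (h1 : ∀ h, x.fst h = y.fst h) (h2 : ∀ h, x.snd h = y.snd h) :
    x = y :=
  WithLp.ofLp_injective 2 (Prod.ext (HSp.ext h1) (HSp.ext h2))

variable (lam) in
/-- The rotations that make up the wave semigroup. -/
noncomputable def waveRot (t : ℝ) : BH lam 0 →L[ℝ] BH lam 0 :=
  LinearMap.mkContinuous
    { toFun := fun x => WithLp.toLp 2 (waveFst lam t x, waveSnd lam t x)
      map_add' := fun x y => BH.ext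
        (fun h => by
          simp only [WithLp.toLp_fst, WithLp.add_fst, WithLp.add_snd, HSp.add_apply, waveFst,
            HSp.mk_apply]
          ring)
        (fun h => by
          simp only [WithLp.toLp_snd, WithLp.add_fst, WithLp.add_snd, HSp.add_apply, waveSnd,
            HSp.mk_apply]
          ring)
      map_smul' := fun c x => BH.ext
        (fun h => by
          simp only [WithLp.toLp_fst, WithLp.smul_fst, WithLp.smul_snd, HSp.smul_apply, waveFst,
            HSp.mk_apply, RingHom.id_apply]
          ring)
        (fun h => by
          simp only [WithLp.toLp_snd, WithLp.smul_fst, WithLp.smul_snd, HSp.smul_apply, waveSnd,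
            HSp.mk_apply, RingHom.id_apply]
          ring) }
    1 (fun x => by
      rw [one_mul]
      refine (sq_le_sq₀ (norm_nonneg _) (norm_nonneg _)).1 (le_of_eq ?_)
      rw [BH.norm_sq, BH.norm_sq]
      refine tsum_congr fun h => ?_
      simp only [LinearMap.coe_mk, AddHom.coe_mk, WithLp.toLp_fst, WithLp.toLp_snd, waveFst,
        waveSnd, HSp.mk_apply]
      rw [inv_mul_cancel_left₀ (lam.sqrt_pos h).ne']
      linear_combination (x.fst h ^ 2 + ((√|lam h|)⁻¹ * x.snd h) ^ 2) *
        Real.sin_sq_add_cos_sq (√|lam h| * t))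

theorem waveRot_fst (t : ℝ) (x : BH lam 0) (h : ι) :
    (waveRot lam t x).fst h = Real.cos (√|lam h| * t) * x.fst h
      + Real.sin (√|lam h| * t) * ((√|lam h|)⁻¹ * x.snd h) := rfl

theorem waveRot_snd (t : ℝ) (x : BH lam 0) (h : ι) :
    (waveRot lam t x).snd h = √|lam h| * (-Real.sin (√|lam h| * t) * x.fst h
      + Real.cos (√|lam h| * t) * ((√|lam h|)⁻¹ * x.snd h)) := rfl

theorem tendsto_toLp_prod_iff {E F α : Type*} [NormedAddCommGroup E] [NormedSpace ℝ E]
    [NormedAddCommGroup F] [NormedSpace ℝ F] {l : Filter α} {f : α → WithLp 2 (E × F)}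
    {g : WithLp 2 (E × F)} :
    Tendsto f l (𝓝 g) ↔ Tendsto (fun t => (f t).fst) l (𝓝 g.fst) ∧
      Tendsto (fun t => (f t).snd) l (𝓝 g.snd) := by
  rw [(WithLp.prodContinuousLinearEquiv 2 ℝ E F).toHomeomorph.isInducing.tendsto_nhds_iff,
    Prod.tendsto_iff]
  rfl

theorem BH.tendsto_iff {α : Type*} {l : Filter α} {f : α → BH lam r} {g : BH lam r} :
    Tendsto f l (𝓝 g) ↔ Tendsto (fun t => (f t).fst) l (𝓝 g.fst) ∧
      Tendsto (fun t => (f t).snd) l (𝓝 g.snd) :=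
  tendsto_toLp_prod_iff

theorem mem_waveOp_domain {x : BH lam 0} : x ∈ (waveOp lam).domain ↔
    x.fst.coeff ∈ interpSubmodule lam (1 / 2) ∧
      x.snd.coeff ∈ interpSubmodule lam (1 / 2 - 1 / 2) := Iff.rfl

theorem waveOp_fst (z : (waveOp lam).domain) (h : ι) :
    (waveOp lam z).fst h = (z : BH lam 0).snd h :=
  HSp.mk_apply (z : BH lam 0).snd.coeff _ h

theorem waveOp_snd (z : (waveOp lam).domain) (h : ι) :
    (waveOp lam z).snd h = lam h * (z : BH lam 0).fst h := rfl

theorem mem_waveOp_graph {x y : BH lam 0} : (x, y) ∈ (waveOp lam).graph ↔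
    (x.fst.coeff ∈ interpSubmodule lam (1 / 2) ∧ x.snd.coeff ∈ interpSubmodule lam (1 / 2 - 1 / 2))
      ∧ (∀ h, y.fst h = x.snd h) ∧ ∀ h, y.snd h = lam h * x.fst h := by
  rw [LinearPMap.mem_graph_iff]
  constructor
  · rintro ⟨z, hz, hy⟩
    simp only at hz hy
    refine ⟨?_, fun h => ?_, fun h => ?_⟩
    · rw [← hz]
      exact mem_waveOp_domain.1 z.2
    · rw [← hz, ← hy, waveOp_fst]
    · rw [← hz, ← hy, waveOp_snd]
  · rintro ⟨hx, h1, h2⟩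
    refine ⟨⟨x, mem_waveOp_domain.2 hx⟩, rfl, BH.ext (fun h => ?_) fun h => ?_⟩
    · rw [waveOp_fst]
      exact (h1 h).symm
    · rw [waveOp_snd]
      exact (h2 h).symm

theorem tendsto_cos_quot (a : ℝ) :
    Tendsto (fun t : ℝ≥0 => (t : ℝ)⁻¹ * (Real.cos (a * t) - 1)) (𝓝[>] 0) (𝓝 0) := by
  have h1 : HasDerivAt (fun t : ℝ => Real.cos (a * t)) 0 0 := by
    have h2 := ((hasDerivAt_id (0 : ℝ)).const_mul a).cos
    simpa using h2
  have h3 := hasDerivAt_iff_tendsto_slope.1 h1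
  have h4 : Tendsto (fun t : ℝ≥0 => (t : ℝ)) (𝓝[>] 0) (𝓝[≠] 0) :=
    tendsto_nhdsWithin_of_tendsto_nhds_of_eventually_within _
      ((NNReal.continuous_coe.tendsto 0).mono_left nhdsWithin_le_nhds)
      (eventually_nhdsWithin_of_forall fun t ht => by
        simpa using (ne_of_gt ht : t ≠ 0))
  refine (h3.comp h4).congr fun t => ?_
  simp [slope_def_field, div_eq_inv_mul]

theorem tendsto_sin_quot (a : ℝ) :
    Tendsto (fun t : ℝ≥0 => (t : ℝ)⁻¹ * Real.sin (a * t)) (𝓝[>] 0) (𝓝 a) := by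
  have h1 : HasDerivAt (fun t : ℝ => Real.sin (a * t)) a 0 := by
    have h2 := ((hasDerivAt_id (0 : ℝ)).const_mul a).sin
    simpa using h2
  have h3 := hasDerivAt_iff_tendsto_slope.1 h1
  have h4 : Tendsto (fun t : ℝ≥0 => (t : ℝ)) (𝓝[>] 0) (𝓝[≠] 0) :=
    tendsto_nhdsWithin_of_tendsto_nhds_of_eventually_within _
      ((NNReal.continuous_coe.tendsto 0).mono_left nhdsWithin_le_nhds)
      (eventually_nhdsWithin_of_forall fun t ht => by
        simpa using (ne_of_gt ht : t ≠ 0))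
  refine (h3.comp h4).congr fun t => ?_
  simp [slope_def_field, div_eq_inv_mul]

theorem abs_cos_quot_le {a : ℝ} (ha : 0 ≤ a) (t : ℝ≥0) :
    |(t : ℝ)⁻¹ * (Real.cos (a * t) - 1)| ≤ a := by
  rcases eq_or_ne t 0 with rfl | ht
  · simpa using ha
  have ht' : (0 : ℝ) < t := by positivity
  have h1 := Real.abs_cos_sub_cos_le (a * t) 0
  rw [Real.cos_zero, sub_zero, abs_of_nonneg (by positivity : 0 ≤ a * t)] at h1
  rw [abs_mul, abs_inv, abs_of_pos ht', inv_mul_le_iff₀ ht', mul_comm (t : ℝ)]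
  exact h1

theorem abs_sin_quot_le {a : ℝ} (ha : 0 ≤ a) (t : ℝ≥0) :
    |(t : ℝ)⁻¹ * Real.sin (a * t)| ≤ a := by
  rcases eq_or_ne t 0 with rfl | ht
  · simpa using ha
  have ht' : (0 : ℝ) < t := by positivity
  have h1 : |Real.sin (a * t)| ≤ |a * t| := Real.abs_sin_le_abs
  rw [abs_of_nonneg (by positivity : 0 ≤ a * t)] at h1
  rw [abs_mul, abs_inv, abs_of_pos ht', inv_mul_le_iff₀ ht', mul_comm (t : ℝ)]
  exact h1

theorem sq_comb_le {c s K V U : ℝ} (hc : |c| ≤ K) (hs : |s| ≤ K) :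
    (c * V + s * U) ^ 2 ≤ 2 * K ^ 2 * (V ^ 2 + U ^ 2) := by
  have h1 : c ^ 2 ≤ K ^ 2 := sq_le_sq' (abs_le.1 hc).1 (abs_le.1 hc).2
  have h2 : s ^ 2 ≤ K ^ 2 := sq_le_sq' (abs_le.1 hs).1 (abs_le.1 hs).2
  nlinarith [mul_le_mul_of_nonneg_right h1 (sq_nonneg V),
    mul_le_mul_of_nonneg_right h2 (sq_nonneg U), sq_nonneg (c * V - s * U)]

variable (lam)

theorem waveRot_tendsto_zero (x : BH lam 0) :
    Tendsto (fun t : ℝ≥0 => waveRot lam t x) (𝓝 0) (𝓝 x) := by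
  have hb : Summable fun h => 2 * (2 : ℝ) ^ 2 * (x.fst h ^ 2 + ((√|lam h|)⁻¹ * x.snd h) ^ 2) :=
    (x.summable_fst.add x.summable_snd).mul_left _
  have hcos : ∀ θ : ℝ, |Real.cos θ - 1| ≤ 2 := fun θ => by
    rw [abs_le]
    constructor <;> linarith [Real.neg_one_le_cos θ, Real.cos_le_one θ]
  have hsin : ∀ θ : ℝ, |Real.sin θ| ≤ 2 := fun θ => by linarith [Real.abs_sin_le_one θ]
  rw [BH.tendsto_iff]
  constructor
  · refine HSp.tendsto_of_dominated _ _ _ hb (Eventually.of_forall fun t h => ?_) fun h => ?_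
    · have h1 := sq_comb_le (V := x.fst h) (U := (√|lam h|)⁻¹ * x.snd h)
        (hcos (√|lam h| * t)) (hsin (√|lam h| * t))
      refine le_trans (le_of_eq ?_) h1
      rw [waveRot_fst, wt_zero]
      ring
    · have h1 : Continuous fun t : ℝ≥0 => |lam h| ^ ((0 : ℝ) / 2) *
          ((waveRot lam t x).fst h - x.fst h) := by
        simp only [waveRot_fst]
        fun_prop
      simpa [waveRot_fst] using h1.tendsto 0
  · refine HSp.tendsto_of_dominated _ _ _ hb (Eventually.of_forall fun t h => ?_) fun h => ?_
    · have h1 := sq_comb_le (V := x.fst h) (U := (√|lam h|)⁻¹ * x.snd h)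
        ((abs_neg _).trans_le (hsin (√|lam h| * t))) (hcos (√|lam h| * t))
      refine le_trans (le_of_eq ?_) h1
      rw [waveRot_snd, wt_half, mul_sub, inv_mul_cancel_left₀ (lam.sqrt_pos h).ne']
      ring
    · have h1 : Continuous fun t : ℝ≥0 => |lam h| ^ ((0 : ℝ) / 2 - 1 / 2) *
          ((waveRot lam t x).snd h - x.snd h) := by
        simp only [waveRot_snd]
        fun_prop
      simpa [waveRot_snd, mul_inv_cancel_left₀ (lam.sqrt_pos h).ne'] using h1.tendsto 0

theorem waveRot_quot_fst (t : ℝ≥0) (x : BH lam 0) (h : ι) :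
    ((t : ℝ)⁻¹ • (waveRot lam t x - x)).fst h
      = ((t : ℝ)⁻¹ * (Real.cos (√|lam h| * t) - 1)) * x.fst h
        + ((t : ℝ)⁻¹ * Real.sin (√|lam h| * t)) * ((√|lam h|)⁻¹ * x.snd h) := by
  rw [WithLp.smul_fst, WithLp.sub_fst, HSp.smul_apply, HSp.sub_apply, waveRot_fst]
  ring

theorem waveRot_quot_snd (t : ℝ≥0) (x : BH lam 0) (h : ι) :
    ((t : ℝ)⁻¹ • (waveRot lam t x - x)).snd h
      = √|lam h| * (-((t : ℝ)⁻¹ * Real.sin (√|lam h| * t)) * x.fst h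
        + ((t : ℝ)⁻¹ * (Real.cos (√|lam h| * t) - 1)) * ((√|lam h|)⁻¹ * x.snd h)) := by
  have h1 : x.snd h = √|lam h| * ((√|lam h|)⁻¹ * x.snd h) :=
    (mul_inv_cancel_left₀ (lam.sqrt_pos h).ne' _).symm
  rw [WithLp.smul_snd, WithLp.sub_snd, HSp.smul_apply, HSp.sub_apply, waveRot_snd]
  linear_combination -(t : ℝ)⁻¹ * h1

theorem waveRot_quot_fst_tendsto (x : BH lam 0) (h : ι) :
    Tendsto (fun t : ℝ≥0 => ((t : ℝ)⁻¹ • (waveRot lam t x - x)).fst h) (𝓝[>] 0)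
      (𝓝 (x.snd h)) := by
  simp only [waveRot_quot_fst]
  have h1 := ((tendsto_cos_quot √|lam h|).mul_const (x.fst h)).add
    ((tendsto_sin_quot √|lam h|).mul_const ((√|lam h|)⁻¹ * x.snd h))
  rwa [zero_mul, zero_add, mul_inv_cancel_left₀ (lam.sqrt_pos h).ne'] at h1

theorem waveRot_quot_snd_tendsto (x : BH lam 0) (h : ι) :
    Tendsto (fun t : ℝ≥0 => ((t : ℝ)⁻¹ • (waveRot lam t x - x)).snd h) (𝓝[>] 0)
      (𝓝 (lam h * x.fst h)) := by
  simp only [waveRot_quot_snd]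
  have h1 := (((tendsto_sin_quot √|lam h|).neg.mul_const (x.fst h)).add
    ((tendsto_cos_quot √|lam h|).mul_const ((√|lam h|)⁻¹ * x.snd h))).const_mul √|lam h|
  convert h1 using 2
  nth_rewrite 1 [lam.eq_neg_sq h]
  ring

/-- `t ↦ waveRot t` is the strongly continuous semigroup generated by `𝐀`. -/
theorem waveRot_isC0SemigroupGeneratedBy :
    IsC0SemigroupGeneratedBy (fun t : ℝ≥0 => waveRot lam t) (waveOp lam) where
  map_zero := by
    refine ContinuousLinearMap.ext fun x => BH.ext (fun h => ?_) fun h => ?_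
    · simp [waveRot_fst]
    · simp [waveRot_snd, mul_inv_cancel_left₀ (lam.sqrt_pos h).ne']
  map_add s t := by
    refine ContinuousLinearMap.ext fun x => BH.ext (fun h => ?_) fun h => ?_
    · have h0 : √|lam h| * ((s + t : ℝ≥0) : ℝ) = √|lam h| * s + √|lam h| * t := by push_cast; ring
      rw [ContinuousLinearMap.comp_apply, waveRot_fst, waveRot_fst, waveRot_fst, waveRot_snd,
        inv_mul_cancel_left₀ (lam.sqrt_pos h).ne', h0, Real.cos_add,
        Real.sin_add]
      ring
    · have h0 : √|lam h| * ((s + t : ℝ≥0) : ℝ) = √|lam h| * s + √|lam h| * t := by push_cast; ring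
      rw [ContinuousLinearMap.comp_apply, waveRot_snd, waveRot_snd, waveRot_fst, waveRot_snd,
        inv_mul_cancel_left₀ (lam.sqrt_pos h).ne', h0, Real.cos_add,
        Real.sin_add]
      ring
  tendsto_zero := waveRot_tendsto_zero lam
  generator x y := by
    rw [mem_waveOp_graph]
    constructor
    · rintro ⟨⟨hx1, hx2⟩, hy1, hy2⟩
      have s1 : Summable fun h => (√|lam h| * x.fst h) ^ 2 :=
        hx1.congr fun h => by rw [wt_sqrt]
      have s2 : Summable fun h => x.snd h ^ 2 :=
        hx2.congr fun h => by rw [wt_one, one_mul]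
      have hb : Summable fun h => 2 * (2 * √|lam h|) ^ 2 *
          (x.fst h ^ 2 + ((√|lam h|)⁻¹ * x.snd h) ^ 2) := by
        refine ((s1.add s2).mul_left 8).congr fun h => ?_
        have := (lam.sqrt_pos h).ne'
        field_simp
        ring
      rw [BH.tendsto_iff]
      constructor
      · refine HSp.tendsto_of_dominated _ _ _ hb (Eventually.of_forall fun t h => ?_) fun h => ?_
        · have ha := (lam.sqrt_pos h)
          have h1 : |(t : ℝ)⁻¹ * (Real.cos (√|lam h| * t) - 1)| ≤ 2 * √|lam h| :=
            (abs_cos_quot_le ha.le t).trans (by linarith)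
          have h2 : |(t : ℝ)⁻¹ * Real.sin (√|lam h| * t) - √(|lam h|)| ≤ 2 * √|lam h| := by
            have h3 := abs_le.1 (abs_sin_quot_le ha.le t)
            rw [abs_le]
            constructor <;> linarith
          refine le_trans (le_of_eq ?_)
            (sq_comb_le (V := x.fst h) (U := (√|lam h|)⁻¹ * x.snd h) h1 h2)
          rw [waveRot_quot_fst, hy1, wt_zero, sub_mul, mul_inv_cancel_left₀ ha.ne']
          ring
        · simpa [hy1] using (waveRot_quot_fst_tendsto lam x h).sub_const (x.snd h)
      · refine HSp.tendsto_of_dominated _ _ _ hb (Eventually.of_forall fun t h => ?_) fun h => ?_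
        · have ha := (lam.sqrt_pos h)
          have h1 : |(t : ℝ)⁻¹ * (Real.cos (√|lam h| * t) - 1)| ≤ 2 * √|lam h| :=
            (abs_cos_quot_le ha.le t).trans (by linarith)
          have h2 : |√|lam h| - (t : ℝ)⁻¹ * Real.sin (√|lam h| * t)| ≤ 2 * √|lam h| := by
            have h3 := abs_le.1 (abs_sin_quot_le ha.le t)
            rw [abs_le]
            constructor <;> linarith
          refine le_trans (le_of_eq ?_)
            (sq_comb_le (V := x.fst h) (U := (√|lam h|)⁻¹ * x.snd h) h2 h1)
          have h4 := lam.eq_neg_sq h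
          rw [waveRot_quot_snd, hy2, wt_half, mul_sub, inv_mul_cancel_left₀ ha.ne']
          have h5 : (√|lam h|)⁻¹ * (lam h * x.fst h) = -(√|lam h| * x.fst h) := by
            nth_rewrite 2 [h4]
            field_simp
          rw [h5]
          ring
        · have h1 := ((waveRot_quot_snd_tendsto lam x h).sub_const (lam h * x.fst h)).const_mul
            (|lam h| ^ ((0 : ℝ) / 2 - 1 / 2))
          simpa [hy2] using h1
    · intro hlim
      rw [BH.tendsto_iff] at hlim
      have hy1 : ∀ h, y.fst h = x.snd h := fun h =>
        tendsto_nhds_unique (HSp.tendsto_apply hlim.1 h) (waveRot_quot_fst_tendsto lam x h)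
      have hy2 : ∀ h, y.snd h = lam h * x.fst h := fun h =>
        tendsto_nhds_unique (HSp.tendsto_apply hlim.2 h) (waveRot_quot_snd_tendsto lam x h)
      refine ⟨⟨?_, ?_⟩, hy1, hy2⟩
      · refine y.summable_snd.congr fun h => ?_
        have ha := (lam.sqrt_pos h).ne'
        have h5 : (√|lam h|)⁻¹ * (lam h * x.fst h) = -(√|lam h| * x.fst h) := by
          nth_rewrite 2 [lam.eq_neg_sq h]
          field_simp
        rw [wt_sqrt, hy2, h5, neg_sq]
      · refine y.summable_fst.congr fun h => ?_
        rw [wt_one, one_mul, hy1]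

theorem exists_waveSemigroup :
    ∃ S : ℝ≥0 → BH lam 0 →L[ℝ] BH lam 0, IsC0SemigroupGeneratedBy S (waveOp lam) :=
  ⟨_, waveRot_isC0SemigroupGeneratedBy lam⟩

/-- `e^{t𝐀}`, `t ≥ 0`: the strongly continuous semigroup on `𝐇_0` generated by `𝐀`. -/
noncomputable def waveSemigroup : ℝ≥0 → BH lam 0 →L[ℝ] BH lam 0 :=
  Classical.choose (exists_waveSemigroup lam)

theorem waveSemigroup_spec : IsC0SemigroupGeneratedBy (waveSemigroup lam) (waveOp lam) :=
  Classical.choose_spec (exists_waveSemigroup lam)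

end WaveSemigroup

/-! ### Cylindrical Wiener processes and stochastic integrals of deterministic integrands -/

section Wiener

variable {Ω : Type*} [mΩ : MeasurableSpace Ω]

/-- Normal filtration `(𝔽_t)_{t ∈ [0,T]}`: every `𝔽_t` contains the `P`-null events, and
`𝔽_t = ⋂_{s ∈ (t,T]} 𝔽_s` for `t < T`. -/
structure IsNormalFiltration {T : ℝ} (P : Measure Ω) (𝔽 : Filtration (Icc (0 : ℝ) T) mΩ) :
    Prop where
  null_mem : ∀ t, ∀ N, MeasurableSet N → P N = 0 → MeasurableSet[𝔽 t] N
  right_cont : ∀ t : Icc (0 : ℝ) T, (t : ℝ) < T → 𝔽 t = ⨅ s > t, 𝔽 s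

/-- `Id_H`-cylindrical Wiener process with respect to the filtration `𝔽`. Here `W t v` is the
real random variable usually written `⟨v, W_t⟩_H`: it is linear in `v`, and for each `v` it is an
`𝔽`-Brownian motion with variance `t ‖v‖²`. -/
structure IsCylindricalWiener {T : ℝ} {H : Type*} [NormedAddCommGroup H] [InnerProductSpace ℝ H]
    (P : Measure Ω) (𝔽 : Filtration (Icc (0 : ℝ) T) mΩ) (W : Icc (0 : ℝ) T → H → Ω → ℝ) :
    Prop where
  adapted : ∀ t v, Measurable[𝔽 t] (W t v)
  linear : ∀ t (c d : ℝ) (u v : H), W t (c • u + d • v) =ᵐ[P] fun ω => c * W t u ω + d * W t v ω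
  zero : ∀ t : Icc (0 : ℝ) T, (t : ℝ) = 0 → ∀ v, W t v =ᵐ[P] 0
  gaussian : ∀ s t : Icc (0 : ℝ) T, s ≤ t → ∀ v,
    HasLaw (fun ω => W t v ω - W s v ω)
      (gaussianReal 0 (Real.toNNReal (((t : ℝ) - s) * ‖v‖ ^ 2))) P
  indep : ∀ s t : Icc (0 : ℝ) T, s ≤ t → ∀ v,
    Indep ((borel ℝ).comap fun ω => W t v ω - W s v ω) (𝔽 s) P
  continuous : ∀ v, ∀ᵐ ω ∂P, Continuous fun t => W t v ω

variable {T : ℝ} {H E : Type*} [NormedAddCommGroup H] [InnerProductSpace ℝ H]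
  [NormedAddCommGroup E] [InnerProductSpace ℝ E]

/-- The data of an elementary integrand `1_{(a,b]}(s) ⟨u, ·⟩ x` with `u ∈ H`, `x ∈ E`. -/
structure ElemTerm (T : ℝ) (H E : Type*) where
  a : Icc (0 : ℝ) T
  b : Icc (0 : ℝ) T
  le : a ≤ b
  u : H
  x : E

/-- The finite-rank step function `s ↦ ∑_j 1_{(a_j,b_j]}(s) ⟨u_j, ·⟩ x_j`. -/
noncomputable def elemIntegrand (L : List (ElemTerm T H E)) (s : ℝ) : H →L[ℝ] E :=
  (L.map fun j => (Ioc (j.a : ℝ) j.b).indicator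
    (fun _ => InnerProductSpace.rankOne ℝ j.x j.u) s).sum

/-- Its stochastic integral `∑_j (⟨u_j, W_{b_j}⟩ - ⟨u_j, W_{a_j}⟩) x_j` over `[0,T]`. -/
noncomputable def elemIntegral (W : Icc (0 : ℝ) T → H → Ω → ℝ) (L : List (ElemTerm T H E))
    (ω : Ω) : E :=
  (L.map fun j => (W j.b j.u ω - W j.a j.u ω) • j.x).sum

/-- The squared Hilbert–Schmidt norm of `Φ : H → E`, computed in the orthonormal basis `b`. -/
noncomputable def hsNormSq {ι : Type*} (b : HilbertBasis ι ℝ H) (Φ : H →L[ℝ] E) : ℝ≥0∞ :=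
  ∑' h, ‖Φ (b h)‖ₑ ^ 2

/-- `X = ∫_0^T Φ_s dW_s` almost surely, for a deterministic integrand `Φ` with values in the
Hilbert–Schmidt operators from `H` to `E`: `X` is the `L²(P; E)`-limit of the integrals of
elementary integrands that converge to `Φ` in `L²([0,T]; HS(H, E))`. -/
def IsStochIntegral {ι : Type*} (b : HilbertBasis ι ℝ H) (P : Measure Ω)
    (W : Icc (0 : ℝ) T → H → Ω → ℝ) (Φ : ℝ → H →L[ℝ] E) (X : Ω → E) : Prop :=
  ∃ L : ℕ → List (ElemTerm T H E),
    Tendsto (fun n => ∫⁻ s in Icc 0 T, hsNormSq b (Φ s - elemIntegrand (L n) s)) atTop (𝓝 0) ∧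
    Tendsto (fun n => eLpNorm (fun ω => elemIntegral W (L n) ω - X ω) 2 P) atTop (𝓝 0)

end Wiener

/-! ### The test functions -/

/-- `C²_b(V, ℝ)`: bounded and twice continuously Fréchet differentiable with bounded
derivatives. -/
def MemCb2 {V : Type*} [NormedAddCommGroup V] [NormedSpace ℝ V] (f : V → ℝ) : Prop :=
  ContDiff ℝ 2 f ∧ ∀ k ≤ 2, ∃ C : ℝ, ∀ x, ‖iteratedFDeriv ℝ k f x‖ ≤ C

/-- `φ_i (v_1, v_2) = exp (-‖v_i‖²_{H_{1/2-i/2}})` on `𝐇_0 = H_0 × H_{-1/2}`, `i ∈ {1, 2}`. -/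
noncomputable def testFun {ι : Type*} (lam : NegSpectrum ι) (i : ℕ) (x : BH lam 0) : ℝ :=
  if i = 1 then Real.exp (-‖x.fst‖ ^ 2) else Real.exp (-‖x.snd‖ ^ 2)

end StochWave

open StochWave

/-!
The random variable `X I` is a centered Gaussian element of `𝐇_0` whose modes are independent. Up to
the weight of the norm, the coordinate of the mode `h` in the first (second) component is
`∫ μ_h ω⁻¹ sin (ω (T - s)) dβ_s` (with `cos` in place of `sin`), where `ω = √|λ_h|` and `β` is the
Brownian motion `⟨h, W⟩`. Its variance is
`v_h = μ_h² / |λ_h| · T/2 · (1 - sin x / x)` with `x = 2 ω T` (`+` for the second component) if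
`h ∈ I`, and `0` otherwise. Since `E exp (-Z²) = (1 + 2v)^(-1/2)` for `Z ∼ N(0, v)`, the expectation
of the test function is the product of the `(1 + 2 v_h)^(-1/2)` over `h ∈ I`
(`hasProd_integral_testFun`). Cutting the product off after `N` factors changes it by at least
`(∑_{n > N} v_n) exp (-2 ∑_n v_n)` (`tsum_mul_exp_le_prod_sub`), and comparing the sums over
`n ^ (4δ - 2)` with integrals gives the stated constants (`weak_error_bound`).

Two facts lead to the Gaussian law. The semigroup is only known through its generator; on the basis
vectors it has to be the solution of the harmonic oscillator, because a curve of the form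
`s ↦ e^{s𝐀} R_{t-s}` has vanishing right derivative
(`IsC0SemigroupGeneratedBy.apply_basisVec`). The stochastic integral is only known as a limit of
elementary integrals. A functional of an elementary integral is Gaussian with the variance given by
the Itô isometry, by induction over the endpoints of the time intervals and the independence of the
increments (`IsCylindricalWiener.charFun_stoppedElemIntegral`); characteristic functions carry this
over to the limit (`IsStochIntegral.charFun_map`).
-/

namespace StochWave

/-! ### Smoothness of the test functions -/

theorem hasFDerivAt_exp_neg_norm_sq {V : Type*} [NormedAddCommGroup V] [InnerProductSpace ℝ V]
    (x : V) : HasFDerivAt (fun v : V => Real.exp (-‖v‖ ^ 2))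
      ((-2 * Real.exp (-‖x‖ ^ 2)) • innerSL ℝ x) x := by
  have h := ((hasStrictFDerivAt_norm_sq x).hasFDerivAt.neg).exp
  refine h.congr_fderiv ?_
  ext y
  simp
  ring

/-- The inner product of a real inner product space as a continuous bilinear map. It agrees with
`innerSL ℝ`, whose type carries the conjugation of `ℝ`. -/
noncomputable def innerBilin (V : Type*) [NormedAddCommGroup V] [InnerProductSpace ℝ V] :
    V →L[ℝ] V →L[ℝ] ℝ :=
  LinearMap.mkContinuous₂ (innerₗ V) 1 fun x y => by
    simpa using norm_inner_le_norm (𝕜 := ℝ) x y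

theorem innerBilin_apply {V : Type*} [NormedAddCommGroup V] [InnerProductSpace ℝ V] (x : V) :
    innerBilin V x = innerSL ℝ x := rfl

theorem hasFDerivAt_fderiv_exp_neg_norm_sq {V : Type*} [NormedAddCommGroup V]
    [InnerProductSpace ℝ V] (x : V) :
    HasFDerivAt (fderiv ℝ fun v : V => Real.exp (-‖v‖ ^ 2))
      ((-2 * Real.exp (-‖x‖ ^ 2)) • innerBilin V +
        ((4 * Real.exp (-‖x‖ ^ 2)) • innerSL ℝ x).smulRight (innerSL ℝ x)) x := by
  have h1 : (fderiv ℝ fun v : V => Real.exp (-‖v‖ ^ 2)) =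
      fun x => (-2 * Real.exp (-‖x‖ ^ 2)) • innerBilin V x :=
    funext fun x => (hasFDerivAt_exp_neg_norm_sq x).fderiv
  rw [h1]
  have h2 := ((hasFDerivAt_exp_neg_norm_sq x).const_mul (-2)).smul
    ((innerBilin V).hasFDerivAt (x := x))
  refine h2.congr_fderiv ?_
  ext y z
  simp [innerBilin_apply]
  exact Or.inl (by ring)

theorem memCb2_exp_neg_norm_sq (V : Type*) [NormedAddCommGroup V] [InnerProductSpace ℝ V] :
    MemCb2 fun v : V => Real.exp (-‖v‖ ^ 2) := by
  -- `exp (-r) (1 + r) ≤ 1` bounds every polynomial factor of degree at most two.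
  have hexp : ∀ x : V, Real.exp (-‖x‖ ^ 2) * (1 + ‖x‖ ^ 2) ≤ 1 := fun x => by
    have h1 := Real.add_one_le_exp (‖x‖ ^ 2)
    have h2 : Real.exp (-‖x‖ ^ 2) * Real.exp (‖x‖ ^ 2) = 1 := by
      rw [← Real.exp_add, neg_add_cancel, Real.exp_zero]
    nlinarith [Real.exp_pos (-‖x‖ ^ 2)]
  refine ⟨((contDiff_norm_sq ℝ).neg).exp, fun k hk => ⟨8, fun x => ?_⟩⟩
  have hx := hexp x
  have h0 := Real.exp_pos (-‖x‖ ^ 2)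
  have hn := norm_nonneg x
  interval_cases k
  · rw [norm_iteratedFDeriv_zero, Real.norm_of_nonneg h0.le]
    nlinarith
  · rw [norm_iteratedFDeriv_one, (hasFDerivAt_exp_neg_norm_sq x).fderiv, norm_smul,
      innerSL_apply_norm, Real.norm_eq_abs, abs_mul, abs_of_pos h0]
    norm_num
    nlinarith [sq_nonneg (‖x‖ - 1)]
  · rw [← norm_iteratedFDeriv_fderiv, norm_iteratedFDeriv_one,
      (hasFDerivAt_fderiv_exp_neg_norm_sq x).fderiv]
    refine (norm_add_le _ _).trans ?_
    rw [norm_smul, ContinuousLinearMap.norm_smulRight_apply, norm_smul, innerSL_apply_norm,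
      Real.norm_eq_abs, Real.norm_eq_abs, abs_mul, abs_mul, abs_of_pos h0]
    have h3 : ‖innerBilin V‖ ≤ 1 := LinearMap.mkContinuous₂_norm_le _ zero_le_one _
    have h4 : 0 ≤ |(-2 : ℝ)| * Real.exp (-‖x‖ ^ 2) := by positivity
    have h5 := mul_le_mul_of_nonneg_left h3 h4
    norm_num at h5 ⊢
    nlinarith

theorem MemCb2.comp_continuousLinearMap {U V : Type*} [NormedAddCommGroup U] [NormedSpace ℝ U]
    [NormedAddCommGroup V] [NormedSpace ℝ V] {f : V → ℝ} (hf : MemCb2 f) (g : U →L[ℝ] V) :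
    MemCb2 fun x => f (g x) := by
  refine ⟨hf.1.comp g.contDiff, fun k hk => ?_⟩
  obtain ⟨C, hC⟩ := hf.2 k hk
  refine ⟨C * ∏ _ : Fin k, ‖g‖, fun x => ?_⟩
  have h1 := g.iteratedFDeriv_comp_right hf.1 x (i := k) (by exact_mod_cast hk)
  change ‖iteratedFDeriv ℝ k (f ∘ g) x‖ ≤ _
  rw [h1]
  refine (ContinuousMultilinearMap.norm_compContinuousLinearMap_le _ _).trans ?_
  exact mul_le_mul_of_nonneg_right (hC _) (by positivity)

theorem memCb2_testFun {ι : Type*} (lam : NegSpectrum ι) (i : ℕ) : MemCb2 (testFun lam i) := by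
  rcases eq_or_ne i 1 with rfl | hi
  · have h := (memCb2_exp_neg_norm_sq (HSp lam (0 / 2))).comp_continuousLinearMap
      (WithLp.fstL 2 ℝ (HSp lam (0 / 2)) (HSp lam (0 / 2 - 1 / 2)))
    convert h using 1
    funext x
    simp [testFun]
  · have h := (memCb2_exp_neg_norm_sq (HSp lam (0 / 2 - 1 / 2))).comp_continuousLinearMap
      (WithLp.sndL 2 ℝ (HSp lam (0 / 2)) (HSp lam (0 / 2 - 1 / 2)))
    convert h using 1
    funext x
    simp [testFun, hi]

/-! ### Strongly continuous semigroups and the wave semigroup on basis vectors -/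

/-- Weighting the coefficients by `|λ_h|^r` identifies `H_r` with `ℓ²`. -/
noncomputable def HSp.equivLp {ι : Type*} (lam : NegSpectrum ι) (r : ℝ) :
    HSp lam r ≃ₗᵢ[ℝ] lp (fun _ : ι => ℝ) 2 where
  toFun u := ⟨fun h => |lam h| ^ r * u h, by
    refine (memℓp_gen_iff (p := 2) (by norm_num)).2 ?_
    simpa [← abs_mul] using u.summable⟩
  invFun f := HSp.mk (fun h => (|lam h| ^ r)⁻¹ * f h) (by
    have h1 := (memℓp_gen_iff (p := 2) (by norm_num)).1 (lp.memℓp f)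
    refine h1.congr fun h => ?_
    rw [mul_inv_cancel_left₀ (lam.rpow_pos r h).ne']
    simp)
  map_add' u v := by
    ext h
    exact mul_add _ _ _
  map_smul' c u := by
    ext h
    exact mul_left_comm _ _ _
  left_inv u := HSp.ext fun h => inv_mul_cancel_left₀ (lam.rpow_pos r h).ne' _
  right_inv f := by
    ext h
    exact mul_inv_cancel_left₀ (lam.rpow_pos r h).ne' _
  norm_map' u := by
    refine (sq_eq_sq₀ (norm_nonneg _) (norm_nonneg _)).1 ?_
    rw [HSp.norm_sq, ← real_inner_self_eq_norm_sq, lp.inner_eq_tsum]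
    refine tsum_congr fun h => ?_
    rw [real_inner_self_eq_norm_sq, Real.norm_eq_abs, sq_abs]
    rfl

instance {ι : Type*} (lam : NegSpectrum ι) (r : ℝ) : CompleteSpace (HSp lam r) :=
  (completeSpace_congr (e := (HSp.equivLp lam r).toEquiv)
    (HSp.equivLp lam r).isometry.isUniformEmbedding).2 inferInstance

namespace IsC0SemigroupGeneratedBy

section

variable {E : Type*} [NormedAddCommGroup E] [NormedSpace ℝ E] {S : ℝ≥0 → E →L[ℝ] E}
  {A : E →ₗ.[ℝ] E}

theorem norm_nsmul_le (hS : IsC0SemigroupGeneratedBy S A) (n : ℕ) (t : ℝ≥0) :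
    ‖S (n • t)‖ ≤ ‖S t‖ ^ n := by
  induction n with
  | zero =>
    rw [zero_nsmul, hS.map_zero, pow_zero]
    exact ContinuousLinearMap.norm_id_le
  | succ n ih =>
    rw [succ_nsmul, hS.map_add, pow_succ]
    exact (ContinuousLinearMap.opNorm_comp_le _ _).trans
      (mul_le_mul_of_nonneg_right ih (norm_nonneg _))

variable [CompleteSpace E]

/-- By the uniform boundedness principle, a strongly continuous semigroup is bounded near `0`. -/
theorem exists_norm_le_near_zero (hS : IsC0SemigroupGeneratedBy S A) :
    ∃ M : ℝ, ∃ d > 0, ∀ t ≤ d, ‖S t‖ ≤ M := by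
  by_contra! hcon
  have h1 : ∀ n : ℕ, ∃ t : ℝ≥0, t ≤ 1 / ((n : ℝ≥0) + 1) ∧ (n : ℝ) < ‖S t‖ := fun n =>
    hcon n _ (by positivity)
  choose t ht hn using h1
  have ht0 : Tendsto t atTop (𝓝 0) :=
    tendsto_of_tendsto_of_tendsto_of_le_of_le tendsto_const_nhds
      tendsto_one_div_add_atTop_nhds_zero_nat (fun _ => zero_le) ht
  obtain ⟨C, hC⟩ := banach_steinhaus (g := fun n => S (t n)) fun x => by
    obtain ⟨C, hC⟩ := isBounded_iff_forall_norm_le.1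
      (Metric.isBounded_range_of_tendsto _ ((hS.tendsto_zero x).comp ht0))
    exact ⟨C, fun n => hC _ ⟨n, rfl⟩⟩
  obtain ⟨n, hCn⟩ := exists_nat_gt C
  linarith [hn n, hC n]

theorem exists_norm_le (hS : IsC0SemigroupGeneratedBy S A) (R : ℝ≥0) :
    ∃ M : ℝ, ∀ t ≤ R, ‖S t‖ ≤ M := by
  obtain ⟨M, d, hd, hM⟩ := hS.exists_norm_le_near_zero
  obtain ⟨n, hn⟩ := exists_nat_gt (R / d)
  have hn0 : 0 < (n : ℝ≥0) := lt_of_le_of_lt zero_le hn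
  refine ⟨M ^ n, fun t ht => ?_⟩
  have h1 : n • (t / n) = t := by
    rw [nsmul_eq_mul, mul_div_cancel₀ _ hn0.ne']
  have h2 : t / n ≤ d := by
    rw [div_le_iff₀ hn0, mul_comm]
    exact ht.trans ((div_lt_iff₀ hd).1 hn).le
  calc ‖S t‖ = ‖S (n • (t / n))‖ := by rw [h1]
    _ ≤ _ := hS.norm_nsmul_le _ _
    _ ≤ _ := pow_le_pow_left₀ (norm_nonneg _) (hM _ h2) _

theorem continuous_apply (hS : IsC0SemigroupGeneratedBy S A) (x : E) :
    Continuous fun t => S t x := by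
  refine continuous_iff_continuousAt.2 fun t => ?_
  obtain ⟨M, hM⟩ := hS.exists_norm_le (t + 1)
  have hd : Tendsto (fun s : ℝ≥0 => (s - t) + (t - s)) (𝓝 t) (𝓝 0) := by
    have : Continuous fun s : ℝ≥0 => (s - t) + (t - s) := by fun_prop
    simpa using this.tendsto t
  have h1 : Tendsto (fun s : ℝ≥0 => M * ‖S ((s - t) + (t - s)) x - x‖) (𝓝 t) (𝓝 0) := by
    have := (((hS.tendsto_zero x).comp hd).sub_const x).norm.const_mul M
    simpa using this
  refine tendsto_iff_norm_sub_tendsto_zero.2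
    (squeeze_zero' (Eventually.of_forall fun s => norm_nonneg _) ?_ h1)
  filter_upwards [Iio_mem_nhds (lt_add_one t)] with s hs
  rcases le_total s t with hst | hst
  · have h2 : S t x = S s (S (t - s) x) := by
      rw [← ContinuousLinearMap.comp_apply, ← hS.map_add, add_tsub_cancel_of_le hst]
    rw [tsub_eq_zero_of_le hst, zero_add, norm_sub_rev, h2, ← map_sub]
    exact (S s).le_of_opNorm_le (hM s (le_of_lt hs)) _
  · have h2 : S s x = S t (S (s - t) x) := by
      rw [← ContinuousLinearMap.comp_apply, ← hS.map_add, add_tsub_cancel_of_le hst]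
    rw [tsub_eq_zero_of_le hst, add_zero, h2, ← map_sub]
    exact (S t).le_of_opNorm_le (hM t (by simp)) _

end

variable {E : Type*} [NormedAddCommGroup E] [NormedSpace ℝ E] {S : ℝ≥0 → E →L[ℝ] E}
  {A : E →ₗ.[ℝ] E}

theorem hasDerivWithinAt (hS : IsC0SemigroupGeneratedBy S A) {x y : E} (hxy : (x, y) ∈ A.graph)
    {t : ℝ} (ht : 0 ≤ t) :
    HasDerivWithinAt (fun s : ℝ => S s.toNNReal x) (S t.toNNReal y) (Ici t) t := by
  rw [← hasDerivWithinAt_Ioi_iff_Ici, hasDerivWithinAt_iff_tendsto_slope' self_notMem_Ioi]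
  have h1 := (hS.generator x y).1 hxy
  have h2 : Tendsto (fun s : ℝ => (s - t).toNNReal) (𝓝[>] t) (𝓝[>] 0) := by
    refine tendsto_nhdsWithin_of_tendsto_nhds_of_eventually_within _ ?_ ?_
    · have : Continuous fun s : ℝ => (s - t).toNNReal := by fun_prop
      simpa using (this.tendsto t).mono_left nhdsWithin_le_nhds
    · filter_upwards [self_mem_nhdsWithin] with s hs
      simpa using hs
  refine (((S t.toNNReal).continuous.tendsto y).comp (h1.comp h2)).congr' ?_
  filter_upwards [self_mem_nhdsWithin] with s hs
  have hs' : 0 ≤ s - t := sub_nonneg.2 (le_of_lt hs)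
  have h3 : s.toNNReal = t.toNNReal + (s - t).toNNReal := by
    rw [← Real.toNNReal_add ht hs', add_sub_cancel]
  simp only [Function.comp_apply, slope, vsub_eq_sub]
  rw [map_smul, map_sub, Real.coe_toNNReal _ hs', h3, hS.map_add]
  rfl

end IsC0SemigroupGeneratedBy

section

variable {ι : Type*} {lam : NegSpectrum ι} {r : ℝ}

open Classical in
/-- The element of the orthonormal basis of `H` with index `h`, as an element of `H_r`. -/
noncomputable def HSp.basisVec (lam : NegSpectrum ι) (r : ℝ) (h : ι) : HSp lam r :=
  HSp.mk (Pi.single h 1) (summable_of_ne_finset_zero (s := {h}) fun k hk => by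
    rw [Pi.single_eq_of_ne (by simpa using hk), mul_zero, zero_pow two_ne_zero])

open Classical in
theorem HSp.basisVec_apply (h k : ι) : HSp.basisVec lam r h k = (Pi.single h 1 : ι → ℝ) k := rfl

theorem HSp.coeff_basisVec_mem (s : ℝ) (h : ι) :
    (HSp.basisVec lam r h).coeff ∈ interpSubmodule lam s := by
  have h1 : (HSp.basisVec lam r h).coeff = (HSp.basisVec lam s h).coeff := by
    classical
    funext k
    rw [HSp.basisVec_apply, HSp.basisVec_apply]
  rw [h1]
  exact (HSp.basisVec lam s h).summable

theorem basisVec_fst_mem_waveOp_graph (h : ι) :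
    ((WithLp.toLp 2 (HSp.basisVec lam (0 / 2) h, 0) : BH lam 0),
      lam h • (WithLp.toLp 2 (0, HSp.basisVec lam (0 / 2 - 1 / 2) h) : BH lam 0)) ∈
      (waveOp lam).graph := by
  classical
  refine mem_waveOp_graph.2
    ⟨⟨HSp.coeff_basisVec_mem _ h, zero_mem _⟩, fun k => ?_, fun k => ?_⟩
  · simp
  · change lam h * HSp.basisVec lam (0 / 2 - 1 / 2) h k = lam k * HSp.basisVec lam (0 / 2) h k
    rw [HSp.basisVec_apply, HSp.basisVec_apply]
    by_cases hk : k = h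
    · rw [hk]
    · simp [hk]

theorem basisVec_snd_mem_waveOp_graph (h : ι) :
    ((WithLp.toLp 2 (0, HSp.basisVec lam (0 / 2 - 1 / 2) h) : BH lam 0),
      (WithLp.toLp 2 (HSp.basisVec lam (0 / 2) h, 0) : BH lam 0)) ∈ (waveOp lam).graph := by
  refine mem_waveOp_graph.2
    ⟨⟨zero_mem _, HSp.coeff_basisVec_mem _ h⟩, fun k => ?_, fun k => ?_⟩
  · classical
    change HSp.basisVec lam (0 / 2) h k = HSp.basisVec lam (0 / 2 - 1 / 2) h k
    rw [HSp.basisVec_apply, HSp.basisVec_apply]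
  · simp

/-- The semigroup generated by `𝐀` solves the harmonic oscillator in each mode. For
`R_τ = ω⁻¹ sin(ωτ) (h, 0) + cos(ωτ) (0, h)` the curve `s ↦ e^{s𝐀} R_{t-s}` is continuous with
vanishing right derivative, so that its values at `0` and at `t` agree. -/
theorem IsC0SemigroupGeneratedBy.apply_basisVec {S : ℝ≥0 → BH lam 0 →L[ℝ] BH lam 0}
    (hS : IsC0SemigroupGeneratedBy S (waveOp lam)) (h : ι) {t : ℝ} (ht : 0 ≤ t) :
    S t.toNNReal (WithLp.toLp 2 (0, HSp.basisVec lam (0 / 2 - 1 / 2) h)) =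
      (Real.sin (√|lam h| * t) / √|lam h|) • WithLp.toLp 2 (HSp.basisVec lam (0 / 2) h, 0) +
      Real.cos (√|lam h| * t) • WithLp.toLp 2 (0, HSp.basisVec lam (0 / 2 - 1 / 2) h) := by
  set a := √|lam h| with ha
  have ha0 : a ≠ 0 := (lam.sqrt_pos h).ne'
  set e₁ : BH lam 0 := WithLp.toLp 2 (HSp.basisVec lam (0 / 2) h, 0)
  set e₂ : BH lam 0 := WithLp.toLp 2 (0, HSp.basisVec lam (0 / 2 - 1 / 2) h)
  have hcont : ∀ x, Continuous fun s : ℝ => S s.toNNReal x := fun x =>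
    (hS.continuous_apply x).comp continuous_real_toNNReal
  let g : ℝ → BH lam 0 := fun s => (Real.sin (a * (t - s)) / a) • S s.toNNReal e₁ +
    Real.cos (a * (t - s)) • S s.toNNReal e₂
  have hg : ContinuousOn g (Icc 0 t) := by
    have h1 := hcont e₁
    have h2 := hcont e₂
    have h3 : Continuous fun s : ℝ => Real.sin (a * (t - s)) / a := by fun_prop
    have h4 : Continuous fun s : ℝ => Real.cos (a * (t - s)) := by fun_prop
    exact ((h3.smul h1).add (h4.smul h2)).continuousOn
  have hd : ∀ s ∈ Ico 0 t, HasDerivWithinAt g 0 (Ici s) s := by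
    intro s hs
    have h1 := hS.hasDerivWithinAt (basisVec_fst_mem_waveOp_graph h) hs.1
    have h2 := hS.hasDerivWithinAt (basisVec_snd_mem_waveOp_graph h) hs.1
    have hlin : HasDerivAt (fun s : ℝ => a * (t - s)) (-a) s := by
      simpa using ((hasDerivAt_id s).const_sub t).const_mul a
    have h3 := (hlin.sin.div_const a).hasDerivWithinAt (s := Ici s)
    have h4 := hlin.cos.hasDerivWithinAt (s := Ici s)
    refine ((h3.smul h1).add (h4.smul h2)).congr_deriv ?_
    rw [map_smul, lam.eq_neg_sq h, ← ha]
    have e1 : Real.cos (a * (t - s)) * -a / a = -Real.cos (a * (t - s)) := by field_simp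
    have e2 : Real.sin (a * (t - s)) / a * -a ^ 2 = -(Real.sin (a * (t - s)) * a) := by
      field_simp
    rw [e1, smul_smul, e2]
    module
  have h5 := constant_of_has_deriv_right_zero hg hd t (right_mem_Icc.2 ht)
  simpa [g, hS.map_zero] using h5

end

/-! ### Gaussian law of stochastic integrals of deterministic integrands -/

section

variable {Ω : Type*} {T : ℝ} {H E : Type*} [NormedAddCommGroup E] [InnerProductSpace ℝ E]

/-- The functional `ℓ` applied to the elementary integral, with all times stopped at `t`. -/
noncomputable def stoppedElemIntegral (W : Icc (0 : ℝ) T → H → Ω → ℝ) (ℓ : E →L[ℝ] ℝ)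
    (L : List (ElemTerm T H E)) (t : Icc (0 : ℝ) T) (ω : Ω) : ℝ :=
  (L.map fun j => ℓ j.x * (W (min j.b t) j.u ω - W (min j.a t) j.u ω)).sum

theorem stoppedElemIntegral_of_coe_eq (W : Icc (0 : ℝ) T → H → Ω → ℝ) (ℓ : E →L[ℝ] ℝ)
    (L : List (ElemTerm T H E)) {t : Icc (0 : ℝ) T} (ht : (t : ℝ) = T) (ω : Ω) :
    stoppedElemIntegral W ℓ L t ω = ℓ (elemIntegral W L ω) := by
  have h1 : ∀ s : Icc (0 : ℝ) T, min s t = s := fun s =>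
    min_eq_left (Subtype.coe_le_coe.1 (by rw [ht]; exact s.2.2))
  induction L with
  | nil => simp [stoppedElemIntegral, elemIntegral]
  | cons j L ih =>
    simp only [stoppedElemIntegral, elemIntegral, List.map_cons, List.sum_cons, map_add, map_smul,
      smul_eq_mul, h1] at ih ⊢
    rw [ih, mul_comm]

end

section

variable {Ω : Type*} [mΩ : MeasurableSpace Ω] {T : ℝ} {H E : Type*} [NormedAddCommGroup H]
  [InnerProductSpace ℝ H] [NormedAddCommGroup E] [InnerProductSpace ℝ E]

/-- The `H`-valued step function representing the functional-valued integrand `ℓ ∘ Ψ_s`, where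
`Ψ` is the elementary integrand of the list `L`. -/
noncomputable def elemVec (ℓ : E →L[ℝ] ℝ) (L : List (ElemTerm T H E)) (s : ℝ) : H :=
  (L.map fun j => (Ioc (j.a : ℝ) j.b).indicator (fun _ => ℓ j.x • j.u) s).sum

theorem inner_elemVec (ℓ : E →L[ℝ] ℝ) (L : List (ElemTerm T H E)) (s : ℝ) (v : H) :
    inner ℝ (elemVec ℓ L s) v = ℓ (elemIntegrand L s v) := by
  induction L with
  | nil => simp [elemVec, elemIntegrand]
  | cons j L ih =>
    simp only [elemVec, elemIntegrand, List.map_cons, List.sum_cons, inner_add_left,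
      add_apply, map_add] at ih ⊢
    rw [ih]
    congr 1
    by_cases hs : s ∈ Ioc (j.a : ℝ) j.b
    · simp [hs, real_inner_smul_left, mul_comm]
    · simp [hs]

theorem stronglyMeasurable_elemVec (ℓ : E →L[ℝ] ℝ) (L : List (ElemTerm T H E)) :
    StronglyMeasurable (elemVec ℓ L) := by
  induction L with
  | nil => exact stronglyMeasurable_const
  | cons j L ih => exact (stronglyMeasurable_const.indicator measurableSet_Ioc).add ih

theorem exists_norm_elemVec_le (ℓ : E →L[ℝ] ℝ) (L : List (ElemTerm T H E)) :
    ∃ C : ℝ, ∀ s, ‖elemVec ℓ L s‖ ≤ C := by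
  induction L with
  | nil => exact ⟨0, fun s => by simp [elemVec]⟩
  | cons j L ih =>
    obtain ⟨C, hC⟩ := ih
    refine ⟨‖ℓ j.x • j.u‖ + C, fun s => ?_⟩
    refine (norm_add_le _ _).trans (add_le_add ?_ (hC s))
    exact norm_indicator_le_norm_self (fun _ => ℓ j.x • j.u) s

theorem memLp_elemVec (ℓ : E →L[ℝ] ℝ) (L : List (ElemTerm T H E)) (μ : Measure ℝ)
    [IsFiniteMeasure μ] : MemLp (elemVec ℓ L) 2 μ := by
  obtain ⟨C, hC⟩ := exists_norm_elemVec_le ℓ L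
  exact MemLp.of_bound (stronglyMeasurable_elemVec ℓ L).aestronglyMeasurable C
    (Eventually.of_forall hC)

theorem intervalIntegrable_norm_elemVec_sq (ℓ : E →L[ℝ] ℝ) (L : List (ElemTerm T H E))
    (s t : ℝ) : IntervalIntegrable (fun r => ‖elemVec ℓ L r‖ ^ 2) volume s t :=
  ⟨(memLp_elemVec ℓ L _).integrable_norm_pow two_ne_zero,
    (memLp_elemVec ℓ L _).integrable_norm_pow two_ne_zero⟩

variable {P : Measure Ω} {𝔽 : Filtration (Icc (0 : ℝ) T) mΩ} {W : Icc (0 : ℝ) T → H → Ω → ℝ}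

theorem IsCylindricalWiener.measurable_stoppedElemIntegral (hW : IsCylindricalWiener P 𝔽 W)
    (ℓ : E →L[ℝ] ℝ) (L : List (ElemTerm T H E)) (t : Icc (0 : ℝ) T) :
    Measurable[𝔽 t] (stoppedElemIntegral W ℓ L t) := by
  have h1 : ∀ (s : Icc (0 : ℝ) T) (u : H), Measurable[𝔽 t] (W (min s t) u) := fun s u =>
    (hW.adapted _ u).mono (𝔽.mono (min_le_right s t)) le_rfl
  induction L with
  | nil => exact measurable_const
  | cons j L ih => exact (((h1 j.b j.u).sub (h1 j.a j.u)).const_mul _).add ih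

/-- If no endpoint lies strictly between `s` and `t`, the integrand is constant on `(s, t]`. -/
theorem elemVec_eq_of_forall_notMem_Ioo (ℓ : E →L[ℝ] ℝ) {L : List (ElemTerm T H E)}
    {s t : Icc (0 : ℝ) T}
    (hL : ∀ j ∈ L, (j.a ≤ s ∨ t ≤ j.a) ∧ (j.b ≤ s ∨ t ≤ j.b)) {r : ℝ} (hr : r ∈ Ioc (s : ℝ) t) :
    elemVec ℓ L r = elemVec ℓ L t := by
  refine congrArg List.sum (List.map_congr_left fun j hj => ?_)
  have hst : (s : ℝ) < t := hr.1.trans_le hr.2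
  have h1 : r ∈ Ioc (j.a : ℝ) j.b ↔ (t : ℝ) ∈ Ioc (j.a : ℝ) j.b := by
    obtain ⟨ha, hb⟩ := hL j hj
    simp only [← Subtype.coe_le_coe] at ha hb
    obtain ⟨hr1, hr2⟩ := hr
    constructor
    · rintro ⟨h2, h3⟩
      exact ⟨h2.trans_le hr2, hb.resolve_left (by linarith)⟩
    · rintro ⟨h2, h3⟩
      exact ⟨(ha.resolve_right (by linarith)).trans_lt hr1, hr2.trans h3⟩
  simp only [indicator, h1]

/-- If no endpoint lies strictly between `s` and `t`, the integral over `(s, t]` is one increment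
of the Wiener process. -/
theorem IsCylindricalWiener.stoppedElemIntegral_sub (hW : IsCylindricalWiener P 𝔽 W)
    (ℓ : E →L[ℝ] ℝ) {L : List (ElemTerm T H E)} {s t : Icc (0 : ℝ) T} (hst : s < t)
    (hL : ∀ j ∈ L, (j.a ≤ s ∨ t ≤ j.a) ∧ (j.b ≤ s ∨ t ≤ j.b)) :
    (fun ω => stoppedElemIntegral W ℓ L t ω - stoppedElemIntegral W ℓ L s ω) =ᵐ[P]
      fun ω => W t (elemVec ℓ L t) ω - W s (elemVec ℓ L t) ω := by
  induction L with
  | nil =>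
    filter_upwards [hW.linear t 0 0 0 0, hW.linear s 0 0 0 0] with ω h1 h2
    simp only [smul_zero, add_zero, zero_mul] at h1 h2
    simp [stoppedElemIntegral, elemVec, h1, h2]
  | cons j L ih =>
    have ih' := ih fun k hk => hL k (List.mem_cons_of_mem _ hk)
    obtain ⟨ha, hb⟩ := hL j List.mem_cons_self
    by_cases ht : (t : ℝ) ∈ Ioc (j.a : ℝ) j.b
    · have hat : j.a < t := ht.1
      have hbt : t ≤ j.b := ht.2
      have has : j.a ≤ s := ha.resolve_right (not_le.2 hat)
      filter_upwards [ih', hW.linear t (ℓ j.x) 1 j.u (elemVec ℓ L t),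
        hW.linear s (ℓ j.x) 1 j.u (elemVec ℓ L t)] with ω h1 h2 h3
      have h4 : elemVec ℓ (j :: L) t = ℓ j.x • j.u + (1 : ℝ) • elemVec ℓ L t := by
        simp [elemVec, ht.1, ht.2]
      rw [h4, h2, h3]
      simp only [stoppedElemIntegral, List.map_cons, List.sum_cons, min_eq_right hbt,
        min_eq_left hat.le, min_eq_left has, min_eq_right (hst.le.trans hbt)] at h1 ⊢
      linear_combination h1
    · have h4 : elemVec ℓ (j :: L) t = elemVec ℓ L t := by
        simp only [elemVec, List.map_cons, List.sum_cons, indicator_of_notMem ht, zero_add]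
      have h5 : ∀ ω, W (min j.b t) j.u ω - W (min j.a t) j.u ω =
          W (min j.b s) j.u ω - W (min j.a s) j.u ω := by
        intro ω
        have hab := j.le
        rcases lt_or_ge j.a t with hat | hat
        · have hbt : j.b < t := not_le.1 fun h => ht ⟨hat, h⟩
          have hbs := hb.resolve_right (not_le.2 hbt)
          rw [min_eq_left hbt.le, min_eq_left hat.le, min_eq_left hbs, min_eq_left (hab.trans hbs)]
        · rw [min_eq_right hat, min_eq_right (hat.trans hab), min_eq_right (hst.le.trans hat),
            min_eq_right (hst.le.trans (hat.trans hab)), sub_self, sub_self]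
      filter_upwards [ih'] with ω h1
      rw [h4]
      simp only [stoppedElemIntegral, List.map_cons, List.sum_cons, h5 ω] at h1 ⊢
      linear_combination h1

/-- The integral of an elementary integrand is centered Gaussian with the variance of the Itô
isometry. Adding the intervals between consecutive endpoints one at a time, each contributes an
increment that is independent of the past. -/
theorem IsCylindricalWiener.charFun_stoppedElemIntegral [IsProbabilityMeasure P]
    (hW : IsCylindricalWiener P 𝔽 W) (ℓ : E →L[ℝ] ℝ) (L : List (ElemTerm T H E))
    (t : Icc (0 : ℝ) T) :
    charFun (P.map (stoppedElemIntegral W ℓ L t)) 1 =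
      Complex.exp ((-(∫ r in (0 : ℝ)..t, ‖elemVec ℓ L r‖ ^ 2) / 2 : ℝ) : ℂ) := by
  classical
  have hT : (0 : ℝ) ≤ T := t.2.1.trans t.2.2
  let z : Icc (0 : ℝ) T := ⟨0, le_rfl, hT⟩
  let F : Finset (Icc (0 : ℝ) T) :=
    insert z ((L.map ElemTerm.a).toFinset ∪ (L.map ElemTerm.b).toFinset)
  induction hn : (F.filter (· < t)).card using Nat.strong_induction_on generalizing t with
  | _ n ih =>
  rcases eq_or_lt_of_le (show z ≤ t from t.2.1) with rfl | hzt
  · have h1 : stoppedElemIntegral W ℓ L z = fun _ => 0 := by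
      funext ω
      have h2 : ∀ s : Icc (0 : ℝ) T, min s z = z := fun s => min_eq_right s.2.1
      simp [stoppedElemIntegral, h2]
    rw [h1, Measure.map_const]
    simp [z]
  have hne : (F.filter (· < t)).Nonempty :=
    ⟨z, Finset.mem_filter.2 ⟨Finset.mem_insert_self _ _, hzt⟩⟩
  set s := (F.filter (· < t)).max' hne with hs
  have hsF := Finset.max'_mem _ hne
  rw [← hs] at hsF
  have hst : s < t := (Finset.mem_filter.1 hsF).2
  have hgap : ∀ p ∈ F, p ≤ s ∨ t ≤ p := fun p hp => by
    rcases lt_or_ge p t with h | h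
    · exact Or.inl (Finset.le_max' _ _ (Finset.mem_filter.2 ⟨hp, h⟩))
    · exact Or.inr h
  have hL : ∀ j ∈ L, (j.a ≤ s ∨ t ≤ j.a) ∧ (j.b ≤ s ∨ t ≤ j.b) := fun j hj =>
    ⟨hgap _ (by simp only [F, Finset.mem_insert, Finset.mem_union, List.mem_toFinset]
                exact Or.inr (Or.inl (List.mem_map_of_mem hj))),
      hgap _ (by simp only [F, Finset.mem_insert, Finset.mem_union, List.mem_toFinset]
                 exact Or.inr (Or.inr (List.mem_map_of_mem hj)))⟩
  have hcard : (F.filter (· < s)).card < n := by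
    rw [← hn]
    refine Finset.card_lt_card (Finset.ssubset_iff_of_subset ?_ |>.2 ⟨s, hsF, by simp⟩)
    intro p hp
    rw [Finset.mem_filter] at hp ⊢
    exact ⟨hp.1, hp.2.trans hst⟩
  have hIH := ih _ hcard s rfl
  set v := elemVec ℓ L t with hv
  have hlaw := hW.gaussian s t hst.le v
  have hmeas := hW.measurable_stoppedElemIntegral ℓ L s
  have hind : IndepFun (fun ω => W t v ω - W s v ω) (stoppedElemIntegral W ℓ L s) P := by
    rw [IndepFun_iff_Indep]
    exact indep_of_indep_of_le_right (hW.indep s t hst.le v) hmeas.comap_le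
  have hsum : stoppedElemIntegral W ℓ L t =ᵐ[P]
      (fun ω => W t v ω - W s v ω) + stoppedElemIntegral W ℓ L s := by
    filter_upwards [hW.stoppedElemIntegral_sub ℓ hst hL] with ω h1
    rw [Pi.add_apply, ← h1, sub_add_cancel]
  have hq : (∫ r in (0 : ℝ)..t, ‖elemVec ℓ L r‖ ^ 2) =
      (∫ r in (0 : ℝ)..s, ‖elemVec ℓ L r‖ ^ 2) + ((t : ℝ) - s) * ‖v‖ ^ 2 := by
    rw [← intervalIntegral.integral_add_adjacent_intervals
      (intervalIntegrable_norm_elemVec_sq ℓ L 0 s) (intervalIntegrable_norm_elemVec_sq ℓ L s t)]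
    congr 1
    rw [intervalIntegral.integral_of_le (le_of_lt hst), setIntegral_congr_fun measurableSet_Ioc
      (g := fun _ => ‖v‖ ^ 2) fun r hr => by
        simp only [elemVec_eq_of_forall_notMem_Ioo ℓ hL hr, hv]]
    rw [setIntegral_const, Real.volume_real_Ioc_of_le (le_of_lt hst), smul_eq_mul]
  have hts : (0 : ℝ) ≤ ((t : ℝ) - s) * ‖v‖ ^ 2 :=
    mul_nonneg (sub_nonneg.2 (le_of_lt hst)) (sq_nonneg _)
  rw [Measure.map_congr hsum, hind.charFun_map_add_eq_mul hlaw.aemeasurable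
    (hmeas.mono (𝔽.le s) le_rfl).aemeasurable, Pi.mul_apply, hIH, hlaw.map_eq,
    charFun_gaussianReal, hq, ← Complex.exp_add, Real.coe_toNNReal _ hts]
  congr 1
  push_cast
  ring

/-- Parseval bounds the vector representing `ℓ ∘ Φ` by the Hilbert–Schmidt norm of `Φ`. -/
theorem enorm_sq_le_hsNormSq [CompleteSpace H] {ι : Type*} (b : HilbertBasis ι ℝ H)
    (ℓ : E →L[ℝ] ℝ) (Φ : H →L[ℝ] E) (g : H) (hg : ∀ h, inner ℝ g (b h) = ℓ (Φ (b h))) :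
    ‖g‖ₑ ^ 2 ≤ ‖ℓ‖ₑ ^ 2 * hsNormSq b Φ := by
  have h1 := b.hasSum_inner_mul_inner g g
  have h2 : ‖g‖ₑ ^ 2 = ∑' h, ‖inner ℝ g (b h)‖ₑ ^ 2 := by
    have h3 : ∀ x : ℝ, ‖x‖ₑ ^ 2 = ENNReal.ofReal (x * x) := fun x => by
      rw [← enorm_pow, sq, Real.enorm_of_nonneg (mul_self_nonneg x)]
    simp_rw [h3]
    rw [← ENNReal.ofReal_tsum_of_nonneg (fun h => mul_self_nonneg _)]
    · rw [← ofReal_norm, ← ENNReal.ofReal_pow (norm_nonneg _), ← real_inner_self_eq_norm_sq,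
        ← h1.tsum_eq]
      congr 1
      exact tsum_congr fun h => by rw [real_inner_comm g (b h)]
    · exact h1.summable.congr fun h => by rw [real_inner_comm g (b h)]
  rw [h2, hsNormSq, ← ENNReal.tsum_mul_left]
  refine ENNReal.tsum_le_tsum fun h => ?_
  rw [hg, ← mul_pow]
  exact pow_le_pow_left₀ zero_le (ℓ.le_opENorm _) 2

end

theorem integral_norm_sq_eq_eLpNorm {α V : Type*} [MeasurableSpace α] {μ : Measure α}
    [NormedAddCommGroup V] {f : α → V} (hf : MemLp f 2 μ) :
    ∫ x, ‖f x‖ ^ 2 ∂μ = (eLpNorm f 2 μ).toReal ^ 2 := by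
  rw [hf.eLpNorm_eq_integral_rpow_norm two_ne_zero ENNReal.ofNat_ne_top,
    ENNReal.toReal_ofReal (by positivity)]
  simp only [ENNReal.toReal_ofNat, Real.rpow_ofNat]
  rw [← Real.rpow_natCast, ← Real.rpow_mul (by positivity)]
  norm_num

theorem tendsto_integral_norm_sq {α V : Type*} [MeasurableSpace α] {μ : Measure α}
    [NormedAddCommGroup V] {f : ℕ → α → V} {g : α → V} (hf : ∀ n, MemLp (f n) 2 μ)
    (hg : MemLp g 2 μ) (h : Tendsto (fun n => eLpNorm (g - f n) 2 μ) atTop (𝓝 0)) :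
    Tendsto (fun n => ∫ x, ‖f n x‖ ^ 2 ∂μ) atTop (𝓝 (∫ x, ‖g x‖ ^ 2 ∂μ)) := by
  simp_rw [integral_norm_sq_eq_eLpNorm (hf _), integral_norm_sq_eq_eLpNorm hg]
  refine ((ENNReal.tendsto_toReal hg.eLpNorm_ne_top).comp ?_).pow 2
  have h1 : Tendsto (fun n => eLpNorm g 2 μ - eLpNorm (g - f n) 2 μ) atTop
      (𝓝 (eLpNorm g 2 μ)) := by
    simpa using ENNReal.Tendsto.sub (tendsto_const_nhds (x := eLpNorm g 2 μ)) h
      (Or.inl hg.eLpNorm_ne_top)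
  have h2 : Tendsto (fun n => eLpNorm g 2 μ + eLpNorm (g - f n) 2 μ) atTop
      (𝓝 (eLpNorm g 2 μ)) := by
    simpa using tendsto_const_nhds.add h
  refine tendsto_of_tendsto_of_tendsto_of_le_of_le h1 h2 (fun n => ?_) fun n => ?_
  · refine tsub_le_iff_right.2 ?_
    have := eLpNorm_add_le (hf n).1 (hg.1.sub (hf n).1) one_le_two
    rwa [add_sub_cancel] at this
  · have := eLpNorm_sub_le hg.1 (hg.1.sub (hf n).1) one_le_two
    rwa [sub_sub_cancel] at this

theorem tendsto_charFun_of_tendsto_eLpNorm {Ω : Type*} [MeasurableSpace Ω] {P : Measure Ω}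
    [IsProbabilityMeasure P] {Z : ℕ → Ω → ℝ} {Y : Ω → ℝ} (hZ : ∀ n, Measurable (Z n))
    (hY : Measurable Y) (h : Tendsto (fun n => eLpNorm (Z n - Y) 2 P) atTop (𝓝 0)) (t : ℝ) :
    Tendsto (fun n => charFun (P.map (Z n)) t) atTop (𝓝 (charFun (P.map Y) t)) := by
  have hmap : ∀ {U : Ω → ℝ}, Measurable U →
      charFun (P.map U) t = ∫ ω, Complex.exp (t * U ω * Complex.I) ∂P := fun {U} hU => by
    rw [charFun_apply_real, integral_map hU.aemeasurable]
    exact Continuous.aestronglyMeasurable (by fun_prop)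
  have hint : ∀ {U : Ω → ℝ}, Measurable U →
      Integrable (fun ω => Complex.exp (t * U ω * Complex.I)) P := fun {U} hU => by
    refine (integrable_const (1 : ℝ)).mono' (Measurable.aestronglyMeasurable (by fun_prop))
      (Eventually.of_forall fun ω => ?_)
    rw [← Complex.ofReal_mul, Complex.norm_exp_ofReal_mul_I]
  rw [tendsto_iff_edist_tendsto_0]
  have h1 : Tendsto (fun n => ‖t‖ₑ * eLpNorm (Z n - Y) 2 P) atTop (𝓝 0) := by
    simpa using ENNReal.Tendsto.const_mul h (Or.inr enorm_ne_top)
  refine tendsto_of_tendsto_of_tendsto_of_le_of_le tendsto_const_nhds h1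
    (fun n => zero_le) fun n => ?_
  dsimp only
  rw [hmap (hZ n), hmap hY, edist_eq_enorm_sub, ← integral_sub (hint (hZ n)) (hint hY)]
  calc ‖∫ ω, (Complex.exp (t * Z n ω * Complex.I) - Complex.exp (t * Y ω * Complex.I)) ∂P‖ₑ
      ≤ ∫⁻ ω, ‖Complex.exp (t * Z n ω * Complex.I) - Complex.exp (t * Y ω * Complex.I)‖ₑ ∂P :=
        enorm_integral_le_lintegral_enorm _
    _ ≤ ∫⁻ ω, ‖t‖ₑ * ‖(Z n - Y) ω‖ₑ ∂P := by
        refine lintegral_mono fun ω => ?_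
        rw [← enorm_mul, enorm_le_iff_norm_le]
        have h2 : Complex.exp (t * Z n ω * Complex.I) - Complex.exp (t * Y ω * Complex.I) =
            Complex.exp (((t * Y ω : ℝ) : ℂ) * Complex.I) *
              (Complex.exp (Complex.I * ((t * (Z n ω - Y ω) : ℝ) : ℂ)) - 1) := by
          rw [mul_sub, ← Complex.exp_add, mul_one]
          push_cast
          ring_nf
        rw [h2, norm_mul, Complex.norm_exp_ofReal_mul_I, one_mul]
        exact Real.norm_exp_I_mul_ofReal_sub_one_le
    _ = ‖t‖ₑ * eLpNorm (Z n - Y) 1 P := by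
        rw [lintegral_const_mul' _ _ enorm_ne_top, eLpNorm_one_eq_lintegral_enorm]
    _ ≤ ‖t‖ₑ * eLpNorm (Z n - Y) 2 P := by
        gcongr
        exact eLpNorm_le_eLpNorm_of_exponent_le one_le_two
          ((hZ n).sub hY).aestronglyMeasurable

section

variable {Ω : Type*} [mΩ : MeasurableSpace Ω] {T : ℝ} {H E : Type*} [NormedAddCommGroup H]
  [InnerProductSpace ℝ H] [CompleteSpace H] [NormedAddCommGroup E] [InnerProductSpace ℝ E]
  {P : Measure Ω} [IsProbabilityMeasure P] {𝔽 : Filtration (Icc (0 : ℝ) T) mΩ}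
  {W : Icc (0 : ℝ) T → H → Ω → ℝ} {ι : Type*} {b : HilbertBasis ι ℝ H}

/-- A stochastic integral of a deterministic integrand `Φ` is Gaussian: if `g s` represents
`ℓ ∘ Φ_s`, then `ℓ(∫ Φ dW)` has the characteristic function of `N(0, ∫ ‖g‖²)`. -/
theorem IsStochIntegral.charFun_map (hT : 0 ≤ T) (hW : IsCylindricalWiener P 𝔽 W)
    {Φ : ℝ → H →L[ℝ] E} {X : Ω → E} (hXm : StronglyMeasurable X)
    (hX : IsStochIntegral b P W Φ X) (ℓ : E →L[ℝ] ℝ) {g : ℝ → H} (hgc : Continuous g)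
    (hg : ∀ s ∈ Icc 0 T, ∀ h, inner ℝ (g s) (b h) = ℓ (Φ s (b h))) :
    charFun (P.map fun ω => ℓ (X ω)) 1 =
      Complex.exp ((-(∫ s in (0 : ℝ)..T, ‖g s‖ ^ 2) / 2 : ℝ) : ℂ) := by
  obtain ⟨L, hL1, hL2⟩ := hX
  let τ : Icc (0 : ℝ) T := ⟨T, hT, le_rfl⟩
  have hZeq : ∀ n, stoppedElemIntegral W ℓ (L n) τ = fun ω => ℓ (elemIntegral W (L n) ω) :=
    fun n => funext fun ω => stoppedElemIntegral_of_coe_eq W ℓ (L n) rfl ω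
  have hZm : ∀ n, Measurable (stoppedElemIntegral W ℓ (L n) τ) := fun n =>
    (hW.measurable_stoppedElemIntegral ℓ (L n) τ).mono (𝔽.le _) le_rfl
  have hYm : Measurable fun ω => ℓ (X ω) := (ℓ.continuous.comp_stronglyMeasurable hXm).measurable
  have h1 : Tendsto (fun n => eLpNorm (stoppedElemIntegral W ℓ (L n) τ - fun ω => ℓ (X ω)) 2 P)
      atTop (𝓝 0) := by
    have h2 : Tendsto (fun n => ‖ℓ‖ₑ *
        eLpNorm (fun ω => elemIntegral W (L n) ω - X ω) 2 P) atTop (𝓝 0) := by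
      simpa using ENNReal.Tendsto.const_mul hL2 (Or.inr enorm_ne_top)
    refine tendsto_of_tendsto_of_tendsto_of_le_of_le tendsto_const_nhds h2
      (fun n => zero_le) fun n => ?_
    refine eLpNorm_le_nnreal_smul_eLpNorm_of_ae_le_mul (c := ‖ℓ‖₊)
      (Eventually.of_forall fun ω => ?_) 2
    rw [hZeq, Pi.sub_apply, ← map_sub]
    exact ℓ.le_opNNNorm _
  have h3 := tendsto_charFun_of_tendsto_eLpNorm hZm hYm h1 1
  refine tendsto_nhds_unique h3 ?_
  simp_rw [hW.charFun_stoppedElemIntegral]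
  refine (Complex.continuous_exp.comp Complex.continuous_ofReal).tendsto _ |>.comp ?_
  refine Tendsto.div_const (Tendsto.neg ?_) 2
  change Tendsto (fun n => ∫ r in (0 : ℝ)..T, ‖elemVec ℓ (L n) r‖ ^ 2) atTop _
  simp_rw [intervalIntegral.integral_of_le hT, ← integral_Icc_eq_integral_Ioc]
  have hgL : MemLp g 2 (volume.restrict (Icc 0 T)) := by
    obtain ⟨C, hC⟩ := (isCompact_Icc (a := 0) (b := T)).exists_bound_of_continuousOn
      hgc.continuousOn
    exact MemLp.of_bound hgc.aestronglyMeasurable C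
      ((ae_restrict_iff' measurableSet_Icc).2 (Eventually.of_forall hC))
  refine tendsto_integral_norm_sq (fun n => memLp_elemVec ℓ (L n) _) hgL ?_
  have h4 : Tendsto (fun n => ‖ℓ‖ₑ ^ 2 *
      ∫⁻ s in Icc 0 T, hsNormSq b (Φ s - elemIntegrand (L n) s)) atTop (𝓝 0) := by
    simpa using ENNReal.Tendsto.const_mul hL1 (Or.inr (ENNReal.pow_ne_top enorm_ne_top))
  have h5 : Tendsto (fun n => ∫⁻ s in Icc 0 T, ‖g s - elemVec ℓ (L n) s‖ₑ ^ 2) atTop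
      (𝓝 0) := by
    refine tendsto_of_tendsto_of_tendsto_of_le_of_le tendsto_const_nhds h4
      (fun n => zero_le) fun n => ?_
    dsimp only
    rw [← lintegral_const_mul' _ _ (ENNReal.pow_ne_top enorm_ne_top)]
    refine setLIntegral_mono' measurableSet_Icc fun s hs => ?_
    refine enorm_sq_le_hsNormSq b ℓ _ _ fun h => ?_
    rw [inner_sub_left, hg s hs, inner_elemVec, sub_apply, map_sub]
  have h6 := (ENNReal.continuous_rpow_const (y := 1 / 2)).tendsto 0 |>.comp h5
  rw [ENNReal.zero_rpow_of_pos (by norm_num)] at h6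
  refine h6.congr fun n => ?_
  rw [eLpNorm_eq_lintegral_rpow_enorm_toReal two_ne_zero ENNReal.ofNat_ne_top]
  simp

end

/-! ### Independent modes and the expectation of the test functions -/

section

variable {ι : Type*} (lam : NegSpectrum ι)

/-- The weighted coordinate `u ↦ |λ_h|^r u_h` of `H_r`, a functional of norm at most `1`. -/
noncomputable def HSp.weightedCoeff (r : ℝ) (h : ι) : HSp lam r →L[ℝ] ℝ :=
  LinearMap.mkContinuous
    { toFun := fun u => |lam h| ^ r * u h
      map_add' := fun u v => mul_add _ _ _
      map_smul' := fun c u => mul_left_comm _ _ _ }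
    1 fun u => by
      rw [one_mul]
      exact HSp.norm_apply_le u h

theorem HSp.weightedCoeff_apply (r : ℝ) (h : ι) (u : HSp lam r) :
    HSp.weightedCoeff lam r h u = |lam h| ^ r * u h := rfl

/-- The coordinate of the mode `h` of the `i`-th component of an element of `𝐇_0`, weighted such
that the squared norm of the component is the sum of the squared coordinates. -/
noncomputable def modeCoord (i : ℕ) (h : ι) : BH lam 0 →L[ℝ] ℝ :=
  if i = 1 then HSp.weightedCoeff lam (0 / 2) h ∘L WithLp.fstL 2 ℝ _ _
  else HSp.weightedCoeff lam (0 / 2 - 1 / 2) h ∘L WithLp.sndL 2 ℝ _ _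

theorem hasSum_modeCoord_sq (i : ℕ) (x : BH lam 0) :
    ∃ s : ℝ, HasSum (fun h => modeCoord lam i h x ^ 2) s ∧ testFun lam i x = Real.exp (-s) := by
  rcases eq_or_ne i 1 with rfl | hi
  · refine ⟨‖x.fst‖ ^ 2, ?_, by simp [testFun]⟩
    rw [HSp.norm_sq]
    simpa [modeCoord, HSp.weightedCoeff_apply] using x.fst.summable.hasSum
  · refine ⟨‖x.snd‖ ^ 2, ?_, by simp [testFun, hi]⟩
    rw [HSp.norm_sq]
    simpa [modeCoord, HSp.weightedCoeff_apply, hi] using x.snd.summable.hasSum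

/-- `sin` for the first and `cos` for the second component: the response of the undamped
oscillator with initial value `0` and initial velocity `1`. -/
noncomputable def modeTrig (i : ℕ) (x : ℝ) : ℝ := if i = 1 then Real.sin x else Real.cos x

theorem continuous_modeTrig (i : ℕ) : Continuous (modeTrig i) := by
  unfold modeTrig
  split_ifs
  · exact Real.continuous_sin
  · exact Real.continuous_cos

variable {lam}

theorem projBH_noiseOp_basis {H : Type*} [NormedAddCommGroup H] [InnerProductSpace ℝ H]
    (b : HilbertBasis ι ℝ H) (mu : ι → ℝ) (hmu : Summable fun h => mu h ^ 2 / |lam h|)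
    (I : Set ι) (h : ι) :
    projBH lam 0 I (noiseOp lam b mu hmu (b h)) =
      I.indicator mu h • WithLp.toLp 2 (0, HSp.basisVec lam (0 / 2 - 1 / 2) h) := by
  classical
  refine BH.ext (fun k => ?_) fun k => ?_
  · change I.indicator (0 : HSp lam (0 / 2)).coeff k = I.indicator mu h * 0
    rw [mul_zero]
    exact indicator_apply_eq_zero.2 fun _ => rfl
  · change I.indicator (fun k => mu k * inner ℝ (b k) (b h)) k =
      I.indicator mu h * HSp.basisVec lam (0 / 2 - 1 / 2) h k
    rw [HSp.basisVec_apply]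
    have h1 := orthonormal_iff_ite.1 b.orthonormal k h
    by_cases hkh : k = h
    · subst hkh
      rw [if_pos rfl] at h1
      simp only [indicator, h1, Pi.single_eq_same, mul_one]
    · rw [if_neg hkh] at h1
      simp only [indicator, h1, Pi.single_eq_of_ne hkh, mul_zero, ite_self]

open Classical in
theorem modeCoord_waveSemigroup_basis {H : Type*} [NormedAddCommGroup H] [InnerProductSpace ℝ H]
    (b : HilbertBasis ι ℝ H) (mu : ι → ℝ) (hmu : Summable fun h => mu h ^ 2 / |lam h|)
    (I : Set ι) (i : ℕ) (h k : ι) {t : ℝ} (ht : 0 ≤ t) :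
    modeCoord lam i k ((waveSemigroup lam t.toNNReal ∘L projBH lam 0 I ∘L noiseOp lam b mu hmu)
      (b h)) = if k = h then I.indicator mu h * modeTrig i (√|lam h| * t) / √|lam h| else 0 := by
  rw [ContinuousLinearMap.comp_apply, ContinuousLinearMap.comp_apply, projBH_noiseOp_basis,
    map_smul, (waveSemigroup_spec lam).apply_basisVec h ht, map_smul, map_add, map_smul, map_smul]
  by_cases hi : i = 1
  · subst hi
    simp only [modeCoord, modeTrig, if_true, ContinuousLinearMap.comp_apply, WithLp.fstL_apply,
      WithLp.toLp_fst, HSp.weightedCoeff_apply, HSp.basisVec_apply, wt_zero, HSp.zero_apply, smul_eq_mul]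
    by_cases hkh : k = h
    · subst hkh
      simp
      ring
    · simp [hkh]
  · simp only [modeCoord, modeTrig, hi, if_false, ContinuousLinearMap.comp_apply,
      WithLp.sndL_apply, WithLp.toLp_snd, HSp.weightedCoeff_apply, HSp.basisVec_apply, wt_half, HSp.zero_apply,
      smul_eq_mul]
    by_cases hkh : k = h
    · subst hkh
      simp
      ring
    · simp [hkh]

/-- The variance of the coordinate of the mode `h` of the `i`-th component of the stochastic
convolution driven by `𝐏_I 𝐁`. -/
noncomputable def modeVar (lam : NegSpectrum ι) (mu : ι → ℝ) (T : ℝ) (I : Set ι) (i : ℕ) (h : ι) :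
    ℝ :=
  ∫ s in (0 : ℝ)..T, (I.indicator mu h * modeTrig i (√|lam h| * (T - s)) / √|lam h|) ^ 2

theorem modeVar_nonneg (mu : ι → ℝ) {T : ℝ} (hT : 0 ≤ T) (I : Set ι) (i : ℕ) (h : ι) :
    0 ≤ modeVar lam mu T I i h :=
  intervalIntegral.integral_nonneg hT fun _ _ => sq_nonneg _

theorem modeVar_of_notMem (mu : ι → ℝ) (T : ℝ) {I : Set ι} (i : ℕ) {h : ι} (hI : h ∉ I) :
    modeVar lam mu T I i h = 0 := by
  simp [modeVar, hI]

theorem modeVar_of_mem (mu : ι → ℝ) (T : ℝ) {I : Set ι} (i : ℕ) {h : ι} (hI : h ∈ I) :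
    modeVar lam mu T I i h = modeVar lam mu T univ i h := by
  simp [modeVar, hI]

end

theorem integral_exp_neg_sq_gaussianReal (v : ℝ≥0) :
    ∫ y, Real.exp (-y ^ 2) ∂(gaussianReal 0 v) = (√(1 + 2 * v))⁻¹ := by
  rcases eq_or_ne v 0 with rfl | hv
  · simp
  have hv0 : (0 : ℝ) < v := by positivity
  rw [integral_gaussianReal_eq_integral_smul hv]
  have h1 : ∀ y : ℝ, gaussianPDFReal 0 v y • Real.exp (-y ^ 2) =
      (√(2 * Real.pi * v))⁻¹ * Real.exp (-(1 / (2 * v) + 1) * y ^ 2) := fun y => by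
    rw [gaussianPDFReal, smul_eq_mul, mul_assoc, ← Real.exp_add]
    congr 2
    ring
  simp_rw [h1]
  rw [integral_const_mul, integral_gaussian, ← Real.sqrt_inv, ← Real.sqrt_inv,
    ← Real.sqrt_mul (by positivity)]
  congr 1
  have := Real.pi_pos
  field_simp

section

variable {Ω : Type*} [mΩ : MeasurableSpace Ω] {T : ℝ} {H : Type*} [NormedAddCommGroup H]
  [InnerProductSpace ℝ H] [CompleteSpace H] {P : Measure Ω} [IsProbabilityMeasure P]
  {𝔽 : Filtration (Icc (0 : ℝ) T) mΩ} {W : Icc (0 : ℝ) T → H → Ω → ℝ} {ι : Type*}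
  {b : HilbertBasis ι ℝ H} {lam : NegSpectrum ι} {mu : ι → ℝ}
  {hmu : Summable fun h => mu h ^ 2 / |lam h|} {I : Set ι} {X : Ω → BH lam 0}

theorem charFun_linearCombination_modeCoord (hT : 0 ≤ T) (hW : IsCylindricalWiener P 𝔽 W)
    (hXm : StronglyMeasurable X)
    (hX : IsStochIntegral b P W
      (fun s => waveSemigroup lam (T - s).toNNReal ∘L projBH lam 0 I ∘L noiseOp lam b mu hmu) X)
    (i : ℕ) (F : Finset ι) (c : ι → ℝ) :
    charFun (P.map fun ω => ∑ k ∈ F, c k * modeCoord lam i k (X ω)) 1 =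
      Complex.exp ((-(∑ k ∈ F, c k ^ 2 * modeVar lam mu T I i k) / 2 : ℝ) : ℂ) := by
  classical
  let ℓ : BH lam 0 →L[ℝ] ℝ := ∑ k ∈ F, c k • modeCoord lam i k
  let a : ι → ℝ → ℝ := fun k s =>
    I.indicator mu k * modeTrig i (√|lam k| * (T - s)) / √|lam k|
  have ha : ∀ k, Continuous (a k) := fun k => by
    have := continuous_modeTrig i
    simp only [a]
    fun_prop
  let g : ℝ → H := fun s => ∑ k ∈ F, (c k * a k s) • b k
  have hgc : Continuous g :=
    continuous_finsetSum _ fun k _ => ((ha k).const_mul (c k)).smul continuous_const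
  have hg : ∀ s ∈ Icc 0 T, ∀ h, inner ℝ (g s) (b h) = ℓ ((waveSemigroup lam (T - s).toNNReal ∘L
      projBH lam 0 I ∘L noiseOp lam b mu hmu) (b h)) := by
    intro s hs h
    simp only [g, ℓ, sum_inner, sum_apply, smul_apply, smul_eq_mul, real_inner_smul_left]
    refine Finset.sum_congr rfl fun k _ => ?_
    rw [modeCoord_waveSemigroup_basis b mu hmu I i h k (sub_nonneg.2 hs.2),
      orthonormal_iff_ite.1 b.orthonormal k h]
    by_cases hkh : k = h
    · subst hkh
      simp [a]
    · simp [hkh]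
  have h1 := hX.charFun_map hT hW hXm ℓ hgc hg
  have h2 : (fun ω => ℓ (X ω)) = fun ω => ∑ k ∈ F, c k * modeCoord lam i k (X ω) := by
    funext ω
    simp [ℓ, sum_apply]
  have h3 : ∀ s, ‖g s‖ ^ 2 = ∑ k ∈ F, c k ^ 2 * a k s ^ 2 := fun s => by
    rw [← real_inner_self_eq_norm_sq, b.orthonormal.inner_sum]
    refine Finset.sum_congr rfl fun k _ => ?_
    simp only [conj_trivial]
    ring
  rw [← h2, h1]
  congr 4
  simp_rw [h3]
  rw [intervalIntegral.integral_finsetSum (f := fun k s => c k ^ 2 * a k s ^ 2) fun k _ =>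
    (((ha k).pow 2).const_mul (c k ^ 2)).intervalIntegrable _ _]
  simp_rw [intervalIntegral.integral_const_mul]
  rfl

theorem map_modeCoord_eq_gaussianReal (hT : 0 ≤ T) (hW : IsCylindricalWiener P 𝔽 W)
    (hXm : StronglyMeasurable X)
    (hX : IsStochIntegral b P W
      (fun s => waveSemigroup lam (T - s).toNNReal ∘L projBH lam 0 I ∘L noiseOp lam b mu hmu) X)
    (i : ℕ) (k : ι) :
    P.map (fun ω => modeCoord lam i k (X ω)) =
      gaussianReal 0 (modeVar lam mu T I i k).toNNReal := by
  have hm : Measurable fun ω => modeCoord lam i k (X ω) :=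
    ((modeCoord lam i k).continuous.comp_stronglyMeasurable hXm).measurable
  have := Measure.isProbabilityMeasure_map (μ := P) hm.aemeasurable
  refine Measure.ext_of_charFun (funext fun t => ?_)
  have h1 := charFun_linearCombination_modeCoord hT hW hXm hX i {k} fun _ => t
  simp only [Finset.sum_singleton] at h1
  rw [charFun_map_mul_comp hm.aemeasurable, mul_one] at h1
  rw [h1, charFun_gaussianReal, Real.coe_toNNReal _ (modeVar_nonneg mu hT I i k)]
  congr 1
  push_cast
  ring

/-- Distinct modes of the stochastic convolution are independent: their joint characteristic
function factorizes. -/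
theorem iIndepFun_modeCoord (hT : 0 ≤ T) (hW : IsCylindricalWiener P 𝔽 W)
    (hXm : StronglyMeasurable X)
    (hX : IsStochIntegral b P W
      (fun s => waveSemigroup lam (T - s).toNNReal ∘L projBH lam 0 I ∘L noiseOp lam b mu hmu) X)
    (i : ℕ) (F : Finset ι) :
    iIndepFun (fun (k : F) ω => modeCoord lam i k (X ω)) P := by
  classical
  have hm : ∀ k, Measurable fun ω => modeCoord lam i k (X ω) := fun k =>
    ((modeCoord lam i k).continuous.comp_stronglyMeasurable hXm).measurable
  refine (iIndepFun_iff_charFun_pi (X := fun (k : F) ω => modeCoord lam i k (X ω))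
    fun k => (hm k).aemeasurable).2 fun t => ?_
  -- Extension of the frequency `t` by zero to all modes.
  let c : ι → ℝ := fun k => if hk : k ∈ F then t ⟨k, hk⟩ else 0
  have hc : ∀ k : F, c k = t k := fun k => by simp [c]
  have h1 := charFun_linearCombination_modeCoord hT hW hXm hX i F c
  have hL : Measurable fun ω => WithLp.toLp 2 fun k : F => modeCoord lam i k (X ω) := by
    exact (PiLp.continuous_toLp 2 fun _ : F => ℝ).measurable.comp
      (measurable_pi_lambda _ fun k : F => hm k)
  have h2 : charFun (P.map fun ω => WithLp.toLp 2 fun k : F => modeCoord lam i k (X ω)) t =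
      charFun (P.map fun ω => ∑ k ∈ F, c k * modeCoord lam i k (X ω)) 1 := by
    rw [charFun_apply, charFun_apply_real, integral_map hL.aemeasurable
      (Continuous.aestronglyMeasurable (by fun_prop)), integral_map
      (Measurable.aemeasurable (Finset.measurable_fun_sum _ fun k _ => (hm k).const_mul _))
      (Continuous.aestronglyMeasurable (by fun_prop))]
    refine integral_congr_ae (Eventually.of_forall fun ω => ?_)
    dsimp only
    rw [PiLp.inner_apply, ← Finset.sum_coe_sort F]
    simp [hc]
  rw [h2, h1]
  have h3 : ∀ k : F, charFun (P.map fun ω => modeCoord lam i k (X ω)) (t k) =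
      Complex.exp ((-(c k ^ 2 * modeVar lam mu T I i k) / 2 : ℝ) : ℂ) := fun k => by
    rw [map_modeCoord_eq_gaussianReal hT hW hXm hX i k, charFun_gaussianReal,
      Real.coe_toNNReal _ (modeVar_nonneg mu hT I i k), ← hc]
    congr 1
    push_cast
    ring
  simp_rw [h3]
  rw [← Complex.exp_sum, ← Finset.sum_coe_sort F]
  congr 1
  push_cast
  rw [← Finset.sum_neg_distrib, Finset.sum_div]

/-- The expectation of the test function factorizes over the modes. -/
theorem hasProd_integral_testFun [Countable ι] (hT : 0 ≤ T) (hW : IsCylindricalWiener P 𝔽 W)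
    (hXm : StronglyMeasurable X)
    (hX : IsStochIntegral b P W
      (fun s => waveSemigroup lam (T - s).toNNReal ∘L projBH lam 0 I ∘L noiseOp lam b mu hmu) X)
    (i : ℕ) :
    HasProd (fun h => (√(1 + 2 * modeVar lam mu T I i h))⁻¹)
      (∫ ω, testFun lam i (X ω) ∂P) := by
  have hm : ∀ k, Measurable fun ω => modeCoord lam i k (X ω) := fun k =>
    ((modeCoord lam i k).continuous.comp_stronglyMeasurable hXm).measurable
  have h1 : ∀ F : Finset ι, ∫ ω, Real.exp (-∑ k ∈ F, modeCoord lam i k (X ω) ^ 2) ∂P =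
      ∏ k ∈ F, (√(1 + 2 * modeVar lam mu T I i k))⁻¹ := fun F => by
    have h2 := (iIndepFun_modeCoord hT hW hXm hX i F).integral_fun_prod_comp
      (f := fun _ y => Real.exp (-y ^ 2)) (fun k => (hm k).aemeasurable)
      fun k => Continuous.aestronglyMeasurable (by fun_prop)
    rw [← Finset.prod_coe_sort F]
    convert h2 using 1
    · refine integral_congr_ae (Eventually.of_forall fun ω => ?_)
      dsimp only
      rw [← Real.exp_sum, Finset.sum_neg_distrib, Finset.sum_coe_sort F
        fun k => modeCoord lam i k (X ω) ^ 2]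
    · refine Finset.prod_congr rfl fun k _ => ?_
      rw [← integral_map (f := fun y => Real.exp (-y ^ 2)) (hm k).aemeasurable
        (Continuous.aestronglyMeasurable (by fun_prop)), map_modeCoord_eq_gaussianReal hT hW hXm hX i k,
        integral_exp_neg_sq_gaussianReal, Real.coe_toNNReal _ (modeVar_nonneg mu hT I i k)]
  change Tendsto (fun F : Finset ι => ∏ k ∈ F, (√(1 + 2 * modeVar lam mu T I i k))⁻¹) atTop _
  simp_rw [← h1]
  refine tendsto_integral_filter_of_dominated_convergence (fun _ => (1 : ℝ))
    (Eventually.of_forall fun F => ?_) (Eventually.of_forall fun F => Eventually.of_forall fun ω =>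
      ?_) (integrable_const _) (Eventually.of_forall fun ω => ?_)
  · exact (Real.measurable_exp.comp
      (Finset.measurable_fun_sum _ fun k _ => (hm k).pow_const 2).neg).aestronglyMeasurable
  · rw [Real.norm_of_nonneg (Real.exp_pos _).le, Real.exp_le_one_iff, neg_nonpos]
    exact Finset.sum_nonneg fun k _ => sq_nonneg _
  · obtain ⟨s, hs, hts⟩ := hasSum_modeCoord_sq lam i (X ω)
    rw [hts]
    exact (Real.continuous_exp.tendsto _).comp (Tendsto.neg hs)

end

/-! ### Infinite products, power sums and the lower bound -/

theorem mul_exp_le_one_sub_inv_sqrt {S : ℝ} (hS : 0 ≤ S) :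
    S * Real.exp (-(2 * S)) ≤ 1 - (√(1 + 2 * S))⁻¹ := by
  set r := √(1 + 2 * S) with hr
  have hr2 : r ^ 2 = 1 + 2 * S := Real.sq_sqrt (by positivity)
  have hr1 : 1 ≤ r := Real.one_le_sqrt.2 (by linarith)
  have hr0 : 0 < r := by linarith
  have h1 : Real.exp (-(2 * S)) ≤ (r ^ 2)⁻¹ := by
    rw [Real.exp_neg, hr2]
    exact inv_anti₀ (by positivity) (by linarith [Real.add_one_le_exp (2 * S)])
  have h2 : S = (r ^ 2 - 1) / 2 := by linarith
  calc S * Real.exp (-(2 * S)) ≤ S * (r ^ 2)⁻¹ := mul_le_mul_of_nonneg_left h1 hS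
    _ ≤ 1 - r⁻¹ := by
      rw [h2, ← sub_nonneg]
      have h3 : 1 - r⁻¹ - (r ^ 2 - 1) / 2 * (r ^ 2)⁻¹ = (r - 1) ^ 2 / (2 * r ^ 2) := by
        field_simp
        ring
      rw [h3]
      positivity

theorem exp_neg_le_inv_sqrt {v : ℝ} (hv : 0 ≤ v) : Real.exp (-v) ≤ (√(1 + 2 * v))⁻¹ := by
  rw [Real.exp_neg]
  refine inv_anti₀ (by positivity) (Real.sqrt_le_iff.2 ⟨(Real.exp_pos v).le, ?_⟩)
  rw [← Real.exp_nat_mul]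
  push_cast
  linarith [Real.add_one_le_exp (2 * v)]

theorem prod_inv_sqrt_le {v : ℕ → ℝ} (hv : ∀ k, 0 ≤ v k) (n : ℕ) :
    ∏ k ∈ Finset.range n, (√(1 + 2 * v k))⁻¹ ≤ (√(1 + 2 * ∑ k ∈ Finset.range n, v k))⁻¹ := by
  induction n with
  | zero => simp
  | succ n ih =>
    have h0 : 0 ≤ ∑ k ∈ Finset.range n, v k := Finset.sum_nonneg fun k _ => hv k
    have hn := hv n
    rw [Finset.prod_range_succ, Finset.sum_range_succ]
    refine (mul_le_mul_of_nonneg_right ih (by positivity)).trans ?_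
    rw [← mul_inv, ← Real.sqrt_mul (by positivity)]
    refine inv_anti₀ (by positivity) (Real.sqrt_le_sqrt ?_)
    nlinarith [mul_nonneg h0 hn]

/-- Truncating the product of the factors `(1 + 2 v_k)^(-1/2)` after `N` terms changes it at least
in proportion to the neglected part of `∑ v_k`. -/
theorem tsum_mul_exp_le_prod_sub {v : ℕ → ℝ} (hv : ∀ k, 0 ≤ v k) (hs : Summable v) {p : ℝ}
    (hp : HasProd (fun k => (√(1 + 2 * v k))⁻¹) p) (N : ℕ) :
    (∑' k, v (N + k)) * Real.exp (-(2 * ∑' k, v k)) ≤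
      ∏ k ∈ Finset.range N, (√(1 + 2 * v k))⁻¹ - p := by
  set Q := ∏ k ∈ Finset.range N, (√(1 + 2 * v k))⁻¹ with hQ
  set S := ∑' k, v (N + k) with hS
  have hsN : Summable fun k => v (N + k) := by
    simpa only [add_comm N] using (summable_nat_add_iff N).2 hs
  have hS0 : 0 ≤ S := tsum_nonneg fun k => hv _
  have hQ0 : 0 ≤ Q := Finset.prod_nonneg fun k _ => by positivity
  have hsplit : ∑' k, v k = ∑ k ∈ Finset.range N, v k + S := by
    rw [← hs.sum_add_tsum_nat_add N, hS]
    simp only [add_comm N]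
  have hp1 : p ≤ Q * (√(1 + 2 * S))⁻¹ := by
    have h1 : Tendsto (fun n => ∏ k ∈ Finset.range (N + n), (√(1 + 2 * v k))⁻¹) atTop (𝓝 p) :=
      hp.tendsto_prod_nat.comp (tendsto_add_atTop_nat N |>.congr fun n => add_comm n N)
    have h2 : Tendsto (fun n => Q * (√(1 + 2 * ∑ k ∈ Finset.range n, v (N + k)))⁻¹) atTop
        (𝓝 (Q * (√(1 + 2 * S))⁻¹)) := by
      refine (Tendsto.inv₀ ?_ (by positivity)).const_mul Q
      exact ((hsN.hasSum.tendsto_sum_nat.const_mul 2).const_add 1).sqrt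
    refine le_of_tendsto_of_tendsto' h1 h2 fun n => ?_
    rw [Finset.prod_range_add]
    exact mul_le_mul_of_nonneg_left (prod_inv_sqrt_le (fun k => hv _) n) hQ0
  have hQ1 : Real.exp (-∑ k ∈ Finset.range N, v k) ≤ Q := by
    rw [← Finset.sum_neg_distrib, Real.exp_sum]
    exact Finset.prod_le_prod (fun k _ => (Real.exp_pos _).le)
      fun k _ => exp_neg_le_inv_sqrt (hv k)
  have hF0 : 0 ≤ ∑ k ∈ Finset.range N, v k := Finset.sum_nonneg fun k _ => hv k
  calc S * Real.exp (-(2 * ∑' k, v k))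
      ≤ S * (Real.exp (-∑ k ∈ Finset.range N, v k) * Real.exp (-(2 * S))) := by
        rw [← Real.exp_add, hsplit]
        gcongr
        linarith
    _ = Real.exp (-∑ k ∈ Finset.range N, v k) * (S * Real.exp (-(2 * S))) := by ring
    _ ≤ Q * (1 - (√(1 + 2 * S))⁻¹) :=
        mul_le_mul hQ1 (mul_exp_le_one_sub_inv_sqrt hS0) (by positivity) hQ0
    _ ≤ Q - p := by linarith

/-- The integral of `y ^ (-p)` over `[x, x + 1]` lies between the values at the endpoints. -/
theorem rpow_telescope {p : ℝ} (hp : 1 < p) {x : ℝ} (hx : 0 < x) :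
    (x + 1) ^ (-p) ≤ (x ^ (1 - p) - (x + 1) ^ (1 - p)) / (p - 1) ∧
      (x ^ (1 - p) - (x + 1) ^ (1 - p)) / (p - 1) ≤ x ^ (-p) := by
  have hd : ∀ y ∈ Icc x (x + 1),
      HasDerivAt (fun y : ℝ => y ^ (1 - p)) ((1 - p) * y ^ (-p)) y := fun y hy => by
    have h1 := Real.hasDerivAt_rpow_const (x := y) (p := 1 - p) (Or.inl (hx.trans_le hy.1).ne')
    rwa [show 1 - p - 1 = -p by ring] at h1
  obtain ⟨c, hc, h2⟩ := exists_hasDerivAt_eq_slope (fun y : ℝ => y ^ (1 - p))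
    (fun y => (1 - p) * y ^ (-p)) (lt_add_one x)
    (fun y hy => (hd y hy).continuousAt.continuousWithinAt) fun y hy => hd y (Ioo_subset_Icc_self hy)
  have hp0 : 0 < p - 1 := by linarith
  have h3 : (x ^ (1 - p) - (x + 1) ^ (1 - p)) / (p - 1) = c ^ (-p) := by
    rw [add_sub_cancel_left, div_one] at h2
    rw [div_eq_iff hp0.ne']
    linarith
  rw [h3]
  exact ⟨Real.rpow_le_rpow_of_nonpos (hx.trans hc.1) hc.2.le (by linarith),
    Real.rpow_le_rpow_of_nonpos hx hc.1.le (by linarith)⟩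

theorem summable_succ_rpow_neg {p : ℝ} (hp : 1 < p) :
    Summable fun k : ℕ => ((k : ℝ) + 1) ^ (-p) := by
  have h1 := (summable_nat_add_iff 1).2 (Real.summable_nat_rpow.2 (neg_lt_neg hp))
  simpa using h1

theorem tsum_succ_rpow_neg_le {p : ℝ} (hp : 1 < p) :
    ∑' k : ℕ, ((k : ℝ) + 1) ^ (-p) ≤ p / (p - 1) := by
  have hp0 : 0 < p - 1 := by linarith
  have h1 : ∀ n : ℕ, ∑ k ∈ Finset.range (n + 1), ((k : ℝ) + 1) ^ (-p) ≤
      p / (p - 1) - ((n : ℝ) + 1) ^ (1 - p) / (p - 1) := fun n => by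
    induction n with
    | zero =>
      refine le_of_eq ?_
      simp only [zero_add, Finset.range_one, Finset.sum_singleton, Nat.cast_zero, Real.one_rpow]
      field_simp
    | succ n ih =>
      rw [Finset.sum_range_succ]
      have h2 := (rpow_telescope hp (x := (n : ℝ) + 1) (by positivity)).1
      rw [sub_div] at h2
      push_cast
      linarith
  refine Real.tsum_le_of_sum_range_le (fun k => by positivity) fun n => ?_
  refine (Finset.sum_le_sum_of_subset_of_nonneg (Finset.range_mono (Nat.le_succ n))
    fun k _ _ => by positivity).trans ((h1 n).trans ?_)
  have : 0 ≤ ((n : ℝ) + 1) ^ (1 - p) / (p - 1) := by positivity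
  linarith

theorem le_tsum_add_rpow_neg {p : ℝ} (hp : 1 < p) {N : ℕ} (hN : 1 ≤ N) :
    (2 * (N : ℝ)) ^ (1 - p) / (p - 1) ≤ ∑' k : ℕ, (((N + k : ℕ) : ℝ) + 1) ^ (-p) := by
  have hp0 : 0 < p - 1 := by linarith
  have hN1 : (1 : ℝ) ≤ N := by exact_mod_cast hN
  have hs : Summable fun k : ℕ => (((N + k : ℕ) : ℝ) + 1) ^ (-p) := by
    simpa only [add_comm N] using (summable_nat_add_iff N).2 (summable_succ_rpow_neg hp)
  have h1 : ∀ n : ℕ, ((N : ℝ) + 1) ^ (1 - p) / (p - 1) - ((n : ℝ) + (N + 1)) ^ (1 - p) / (p - 1) ≤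
      ∑ k ∈ Finset.range n, (((N + k : ℕ) : ℝ) + 1) ^ (-p) := fun n => by
    induction n with
    | zero => simp
    | succ n ih =>
      rw [Finset.sum_range_succ]
      have h2 := (rpow_telescope hp (x := (n : ℝ) + (N + 1)) (by positivity)).2
      rw [sub_div] at h2
      have e1 : ((N + n : ℕ) : ℝ) + 1 = (n : ℝ) + (N + 1) := by push_cast; ring
      have e2 : ((n + 1 : ℕ) : ℝ) + (N + 1) = (n : ℝ) + (N + 1) + 1 := by push_cast; ring
      rw [e1, e2]
      linarith
  have h2 : Tendsto (fun n : ℕ => ((N : ℝ) + 1) ^ (1 - p) / (p - 1) -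
      ((n : ℝ) + (N + 1)) ^ (1 - p) / (p - 1)) atTop (𝓝 (((N : ℝ) + 1) ^ (1 - p) / (p - 1))) := by
    have h3 : Tendsto (fun n : ℕ => ((n : ℝ) + (N + 1)) ^ (-(p - 1))) atTop (𝓝 0) :=
      (tendsto_rpow_neg_atTop hp0).comp
        (tendsto_atTop_add_const_right _ _ tendsto_natCast_atTop_atTop)
    rw [neg_sub] at h3
    simpa using (h3.div_const (p - 1)).const_sub (((N : ℝ) + 1) ^ (1 - p) / (p - 1))
  refine le_trans ?_ (le_of_tendsto_of_tendsto' h2 hs.hasSum.tendsto_sum_nat h1)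
  gcongr ?_ / _
  exact Real.rpow_le_rpow_of_nonpos (by positivity) (by linarith) (by linarith)

/-- The analytic estimate behind the lower bound for the weak error, with variances
`v_k = (T/2) (π(k+1))^(4δ-2) c_k`. -/
theorem weak_error_bound {v : ℕ → ℝ} {δ T κ : ℝ} (hδ : δ < 1 / 4) (hT : 0 < T) (hκ : 0 < κ)
    {c : ℕ → ℝ} (hc1 : ∀ k, κ ≤ c k) (hc2 : ∀ k, c k ≤ 2)
    (hv : ∀ k, v k = T / 2 * (Real.pi * ((k : ℝ) + 1)) ^ (4 * δ - 2) * c k) {p : ℝ}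
    (hp : HasProd (fun k => (√(1 + 2 * v k))⁻¹) p) {N : ℕ} (hN : 1 ≤ N) :
    κ * (T * (4 * Real.pi ^ 2) ^ (2 * δ - 1) * (N : ℝ) ^ (4 * δ - 1) /
        ((1 - 4 * δ) *
          Real.exp (12 * (2 * δ - 1) * T * Real.pi ^ (4 * δ - 2) / (4 * δ - 1)))) ≤
      ∏ k ∈ Finset.range N, (√(1 + 2 * v k))⁻¹ - p := by
  set q := 2 - 4 * δ with hq
  have hq1 : 1 < q := by linarith
  have hq0 : 0 < q - 1 := by linarith
  have hpi := Real.pi_pos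
  have hN0 : (0 : ℝ) < N := by exact_mod_cast hN
  have e0 : 4 * δ - 2 = -q := by ring
  set C := T * Real.pi ^ (-q) with hC
  have hC0 : 0 < C := by positivity
  have hv' : ∀ k : ℕ, v k = C / 2 * ((k : ℝ) + 1) ^ (-q) * c k := fun k => by
    rw [hv, e0, Real.mul_rpow hpi.le (by positivity), hC]
    ring
  have hv0 : ∀ k, 0 ≤ v k := fun k => by
    rw [hv']
    have := hκ.le.trans (hc1 k)
    positivity
  have hvle : ∀ k : ℕ, v k ≤ C * ((k : ℝ) + 1) ^ (-q) := fun k => by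
    rw [hv']
    calc C / 2 * ((k : ℝ) + 1) ^ (-q) * c k ≤ C / 2 * ((k : ℝ) + 1) ^ (-q) * 2 := by
          gcongr
          exact hc2 k
      _ = _ := by ring
  have hvge : ∀ k : ℕ, C / 2 * κ * ((k : ℝ) + 1) ^ (-q) ≤ v k := fun k => by
    rw [hv']
    calc C / 2 * κ * ((k : ℝ) + 1) ^ (-q) = C / 2 * ((k : ℝ) + 1) ^ (-q) * κ := by ring
      _ ≤ _ := by
        gcongr
        exact hc1 k
  have hsq := summable_succ_rpow_neg hq1
  have hs : Summable v := Summable.of_nonneg_of_le hv0 hvle (hsq.mul_left C)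
  have hsqN : Summable fun k : ℕ => (((N + k : ℕ) : ℝ) + 1) ^ (-q) := by
    simpa only [add_comm N] using (summable_nat_add_iff N).2 hsq
  have hsN : Summable fun k => v (N + k) := by
    simpa only [add_comm N] using (summable_nat_add_iff N).2 hs
  have hup : ∑' k, v k ≤ C * (q / (q - 1)) := by
    refine (hs.tsum_le_tsum hvle (hsq.mul_left C)).trans ?_
    rw [tsum_mul_left]
    exact mul_le_mul_of_nonneg_left (tsum_succ_rpow_neg_le hq1) hC0.le
  have hlow : C / 2 * κ * ((2 * (N : ℝ)) ^ (1 - q) / (q - 1)) ≤ ∑' k, v (N + k) := by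
    refine le_trans ?_ ((hsqN.mul_left (C / 2 * κ)).tsum_le_tsum (fun k => hvge _) hsN)
    rw [tsum_mul_left]
    exact mul_le_mul_of_nonneg_left (le_tsum_add_rpow_neg hq1 hN) (by positivity)
  refine le_trans ?_ (tsum_mul_exp_le_prod_sub hv0 hs hp N)
  -- The exponent is six times the bound `hup`; a factor of two would suffice.
  have hK : 12 * (2 * δ - 1) * T * Real.pi ^ (4 * δ - 2) / (4 * δ - 1) =
      6 * (C * (q / (q - 1))) := by
    rw [e0, show 4 * δ - 1 = -(q - 1) by ring, show 2 * δ - 1 = -(q / 2) by ring, hC]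
    field_simp
    ring
  have hpow : (4 * Real.pi ^ 2) ^ (2 * δ - 1) = 2 ^ (-q) * Real.pi ^ (-q) := by
    rw [← Real.mul_rpow zero_le_two hpi.le, show 4 * Real.pi ^ 2 = (2 * Real.pi) ^ (2 : ℝ) by
      rw [Real.rpow_ofNat]; ring, ← Real.rpow_mul (by positivity)]
    congr 1
    ring
  have h2N : (2 * (N : ℝ)) ^ (1 - q) = 2 * 2 ^ (-q) * (N : ℝ) ^ (1 - q) := by
    rw [Real.mul_rpow zero_le_two hN0.le, show (1 : ℝ) - q = 1 + -q by ring,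
      Real.rpow_add zero_lt_two, Real.rpow_one]
  have hlhs : κ * (T * (4 * Real.pi ^ 2) ^ (2 * δ - 1) * (N : ℝ) ^ (4 * δ - 1) /
        ((1 - 4 * δ) *
          Real.exp (12 * (2 * δ - 1) * T * Real.pi ^ (4 * δ - 2) / (4 * δ - 1)))) =
      C / 2 * κ * ((2 * (N : ℝ)) ^ (1 - q) / (q - 1)) * Real.exp (-(6 * (C * (q / (q - 1))))) := by
    rw [hK, hpow, h2N, show 4 * δ - 1 = 1 - q by ring, show 1 - 4 * δ = q - 1 by ring,
      Real.exp_neg, hC]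
    field_simp
  rw [hlhs]
  refine mul_le_mul hlow (Real.exp_le_exp.2 ?_) (Real.exp_pos _).le (tsum_nonneg fun k => hv0 _)
  have : 0 ≤ C * (q / (q - 1)) := by positivity
  linarith

/-- The bound is uniform: a compact interval is followed by `x ≥ 2`, where `|sin x / x| ≤ 1/2`. -/
theorem exists_abs_sin_div_le {a : ℝ} (ha : 0 < a) :
    ∃ c < 1, ∀ x, a ≤ x → |Real.sin x / x| ≤ c := by
  have hcont : ContinuousOn (fun x => |Real.sin x / x|) (Icc a (a + 2)) :=
    (Real.continuous_sin.continuousOn.div continuousOn_id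
      fun x hx => (ha.trans_le hx.1).ne').abs
  obtain ⟨y, hy, hmax⟩ := isCompact_Icc.exists_isMaxOn (nonempty_Icc.2 (by linarith)) hcont
  have hy0 : 0 < y := ha.trans_le hy.1
  refine ⟨max |Real.sin y / y| (1 / 2), max_lt ?_ (by norm_num), fun x hx => ?_⟩
  · rw [abs_div, abs_of_pos hy0, div_lt_one hy0]
    have h1 := Real.abs_sin_lt_abs hy0.ne'
    rwa [abs_of_pos hy0] at h1
  · rcases le_or_gt x (a + 2) with h | h
    · exact le_max_of_le_left (hmax ⟨hx, h⟩)
    · refine le_max_of_le_right ?_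
      have hx0 : 0 < x := ha.trans_le hx
      rw [abs_div, abs_of_pos hx0, div_le_iff₀ hx0]
      linarith [Real.abs_sin_le_one x]

theorem abs_sin_div_neg_one_pow_mul (i : ℕ) (x : ℝ) :
    |Real.sin x / ((-1) ^ i * x)| = |Real.sin x / x| := by
  rw [abs_div, abs_mul, abs_pow, abs_neg, abs_one, one_pow, one_mul, abs_div]

theorem one_add_iInf_sin_div_pos {a : ℝ} (ha : 0 < a) (i : ℕ) :
    0 < 1 + ⨅ x : Ici a, Real.sin x / ((-1) ^ i * (x : ℝ)) := by
  obtain ⟨c, hc, h⟩ := exists_abs_sin_div_le ha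
  have h1 : -c ≤ ⨅ x : Ici a, Real.sin x / ((-1) ^ i * (x : ℝ)) := by
    refine le_ciInf fun x => (abs_le.1 ?_).1
    rw [abs_sin_div_neg_one_pow_mul]
    exact h x x.2
  linarith

theorem iInf_sin_div_le {a : ℝ} (ha : 0 < a) (i : ℕ) {x : ℝ} (hx : a ≤ x) :
    ⨅ x : Ici a, Real.sin x / ((-1) ^ i * (x : ℝ)) ≤ Real.sin x / ((-1) ^ i * x) := by
  obtain ⟨c, hc, h⟩ := exists_abs_sin_div_le ha
  refine ciInf_le (f := fun x : Ici a => Real.sin x / ((-1) ^ i * (x : ℝ))) ⟨-c, ?_⟩ ⟨x, hx⟩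
  rintro _ ⟨y, rfl⟩
  refine (abs_le.1 ?_).1
  rw [abs_sin_div_neg_one_pow_mul]
  exact h y y.2

theorem integral_modeTrig_sq {i : ℕ} (hi : i ∈ ({1, 2} : Set ℕ)) {a T : ℝ} (ha : 0 < a)
    (hT : 0 < T) : ∫ s in (0 : ℝ)..T, modeTrig i (a * (T - s)) ^ 2 =
      T / 2 * (1 + Real.sin (2 * a * T) / ((-1) ^ i * (2 * a * T))) := by
  rw [intervalIntegral.integral_comp_sub_left (fun s => modeTrig i (a * s) ^ 2) T,
    intervalIntegral.integral_comp_mul_left (fun s => modeTrig i s ^ 2) ha.ne', sub_self,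
    sub_zero, mul_zero, smul_eq_mul, mul_assoc 2 a T, Real.sin_two_mul]
  rcases hi with rfl | rfl
  · simp only [modeTrig, if_true]
    rw [integral_sin_sq, Real.sin_zero]
    field_simp
    ring
  · simp only [modeTrig, OfNat.ofNat_ne_one, if_false]
    rw [integral_cos_sq, Real.sin_zero]
    field_simp
    ring

theorem modeVar_univ {ι : Type*} (lam : NegSpectrum ι) (mu : ι → ℝ) {T : ℝ} (hT : 0 < T) {i : ℕ}
    (hi : i ∈ ({1, 2} : Set ℕ)) (h : ι) :
    modeVar lam mu T univ i h = mu h ^ 2 / |lam h| *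
      (T / 2 * (1 + Real.sin (2 * √|lam h| * T) / ((-1) ^ i * (2 * √|lam h| * T)))) := by
  have h1 : ∀ s : ℝ, (univ.indicator mu h * modeTrig i (√|lam h| * (T - s)) / √|lam h|) ^ 2 =
      mu h ^ 2 / |lam h| * modeTrig i (√|lam h| * (T - s)) ^ 2 := fun s => by
    rw [indicator_univ, div_pow, mul_pow, Real.sq_sqrt (abs_nonneg _)]
    ring
  rw [modeVar]
  simp_rw [h1]
  rw [intervalIntegral.integral_const_mul, integral_modeTrig_sq hi (lam.sqrt_pos h) hT]

end StochWave

open StochWave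
theorem corollary2p10 {H : Type*} [NormedAddCommGroup H] [InnerProductSpace ℝ H] [CompleteSpace H]
    [TopologicalSpace.SeparableSpace H]
    {T : ℝ} (hT : 0 < T)
    {Ω : Type*} [mΩ : MeasurableSpace Ω] (P : Measure Ω) [IsProbabilityMeasure P]
    (𝔽 : Filtration (Icc (0 : ℝ) T) mΩ) (h𝔽 : IsNormalFiltration P 𝔽)
    (W : Icc (0 : ℝ) T → H → Ω → ℝ) (hW : IsCylindricalWiener P 𝔽 W)
    -- the orthonormal basis, indexed by `ι`, and the eigenvalues of `A`
    {ι : Type*} (b : HilbertBasis ι ℝ H) (lam : NegSpectrum ι)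
    (mu : ι → ℝ) (hmu : Summable fun h => mu h ^ 2 / |lam h|)
    -- `X I = ∫_0^T e^{(T-s)𝐀} 𝐏_I 𝐁 dW_s`
    (X : Set ι → Ω → BH lam 0) (hX_meas : ∀ I, StronglyMeasurable (X I))
    (hX : ∀ I, IsStochIntegral b P W
      (fun s => waveSemigroup lam (T - s).toNNReal ∘L projBH lam 0 I ∘L noiseOp lam b mu hmu)
      (X I))
    (δ : ℝ) (hδ : δ < 1 / 4)
    (e : ℕ+ → ι) (he : Function.Bijective e)
    (hlam : ∀ n : ℕ+, lam (e n) = -(Real.pi ^ 2 * (n : ℝ) ^ 2))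
    (hmu_eq : ∀ h, |mu h| = |lam h| ^ δ) :
    ∀ i ∈ ({1, 2} : Set ℕ), ∀ N : ℕ+,
      MemCb2 (testFun lam i) ∧
      (∫ ω, testFun lam i (X (e '' Iic N) ω) ∂P) - (∫ ω, testFun lam i (X univ ω) ∂P) ≥
        (1 + ⨅ x : Ici (2 * Real.pi * T), Real.sin x / ((-1) ^ i * (x : ℝ))) *
          (T * (4 * Real.pi ^ 2) ^ (2 * δ - 1) * (N : ℝ) ^ (4 * δ - 1) /
            ((1 - 4 * δ) *
              Real.exp (12 * (2 * δ - 1) * T * Real.pi ^ (4 * δ - 2) / (4 * δ - 1)))) ∧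
      (1 + ⨅ x : Ici (2 * Real.pi * T), Real.sin x / ((-1) ^ i * (x : ℝ))) *
          (T * (4 * Real.pi ^ 2) ^ (2 * δ - 1) * (N : ℝ) ^ (4 * δ - 1) /
            ((1 - 4 * δ) *
              Real.exp (12 * (2 * δ - 1) * T * Real.pi ^ (4 * δ - 2) / (4 * δ - 1)))) > 0 := by
  intro i hi N
  have hpi := Real.pi_pos
  have ha : 0 < 2 * Real.pi * T := by positivity
  have hκ := one_add_iInf_sin_div_pos ha i
  have hN0 : (0 : ℝ) < (N : ℝ) := by exact_mod_cast N.pos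
  refine ⟨memCb2_testFun lam i, ?_, ?_⟩
  swap
  · have : 0 < 1 - 4 * δ := by linarith
    positivity
  -- The modes are numbered from `0` by `k ↦ e (k + 1)`.
  let f : ℕ ≃ ι := Equiv.pnatEquivNat.symm.trans (Equiv.ofBijective e he)
  have hf : ∀ k, f k = e k.succPNat := fun k => rfl
  have hcount : Countable ι := f.symm.injective.countable
  set v : ℕ → ℝ := fun k => modeVar lam mu T univ i (f k) with hv
  have hprod : HasProd (fun k => (√(1 + 2 * v k))⁻¹) (∫ ω, testFun lam i (X univ ω) ∂P) :=
    (f.hasProd_iff (f := fun h => (√(1 + 2 * modeVar lam mu T univ i h))⁻¹)).2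
      (hasProd_integral_testFun hT.le hW (hX_meas univ) (hX univ) i)
  have hmem : ∀ k, f k ∈ e '' Iic N ↔ k < N := fun k => by
    rw [hf, he.1.mem_set_image, mem_Iic, ← PNat.coe_le_coe, Nat.succPNat_coe, Nat.succ_le_iff]
  have hfin : ∫ ω, testFun lam i (X (e '' Iic N) ω) ∂P =
      ∏ k ∈ Finset.range N, (√(1 + 2 * v k))⁻¹ := by
    have h1 := (f.hasProd_iff
      (f := fun h => (√(1 + 2 * modeVar lam mu T (e '' Iic N) i h))⁻¹)).2
      (hasProd_integral_testFun hT.le hW (hX_meas (e '' Iic N)) (hX (e '' Iic N)) i)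
    have h2 := hasProd_prod_of_ne_finset_one (L := .unconditional ℕ) (s := Finset.range N)
      (f := (fun h => (√(1 + 2 * modeVar lam mu T (e '' Iic N) i h))⁻¹) ∘ f) fun k hk => by
        have hk' : f k ∉ e '' Iic N := by
          rw [hmem]
          simpa using hk
        simp [modeVar_of_notMem mu T i hk']
    rw [h1.unique h2]
    refine Finset.prod_congr rfl fun k hk => ?_
    rw [Function.comp_apply, modeVar_of_mem mu T i ((hmem k).2 (Finset.mem_range.1 hk))]
  rw [hfin, ge_iff_le]
  have hlamk : ∀ k, |lam (f k)| = (Real.pi * ((k : ℝ) + 1)) ^ 2 := fun k => by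
    rw [hf, hlam, abs_neg, abs_of_nonneg (by positivity), Nat.succPNat_coe, Nat.cast_succ]
    ring
  have hsqrt : ∀ k, √|lam (f k)| = Real.pi * ((k : ℝ) + 1) := fun k => by
    rw [hlamk, Real.sqrt_sq (by positivity)]
  have hcoef : ∀ k, mu (f k) ^ 2 / |lam (f k)| = (Real.pi * ((k : ℝ) + 1)) ^ (4 * δ - 2) :=
    fun k => by
    have h0 : 0 < Real.pi * ((k : ℝ) + 1) := by positivity
    rw [← sq_abs, hmu_eq, hlamk, ← Real.rpow_natCast (Real.pi * ((k : ℝ) + 1)) 2,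
      ← Real.rpow_mul h0.le, ← Real.rpow_natCast, ← Real.rpow_mul h0.le, ← Real.rpow_sub h0]
    congr 1
    push_cast
    ring
  have hxk : ∀ k : ℕ, 2 * Real.pi * T ≤ 2 * (Real.pi * ((k : ℝ) + 1)) * T := fun k => by
    have h1 : 0 ≤ 2 * Real.pi * T * k := by positivity
    linarith
  refine weak_error_bound hδ hT hκ
    (c := fun k => 1 + Real.sin (2 * (Real.pi * ((k : ℝ) + 1)) * T) /
      ((-1) ^ i * (2 * (Real.pi * ((k : ℝ) + 1)) * T)))
    (fun k => ?_) (fun k => ?_) (fun k => ?_) hprod N.pos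
  · have := iInf_sin_div_le ha i (hxk k)
    linarith
  · obtain ⟨c, hc, h⟩ := exists_abs_sin_div_le ha
    have h1 := h _ (hxk k)
    rw [← abs_sin_div_neg_one_pow_mul i] at h1
    linarith [(abs_le.1 h1).2]
  · simp only [hv]
    rw [modeVar_univ lam mu hT hi, hcoef, hsqrt]
    ring
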